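/- Let $\mathfrak g$ be a simple finite-dimensional complex Lie algebra with Cartan subalgebra $\mathfrak h$, simple roots $\alpha_i\in\mathfrak h^*$, simple coroots $\check\alpha_i\in\mathfrak h$ ($i\in I$), and half-sum of positive roots $\rho$. Let ${}^L\mathfrak g$ be the Langlands dual Lie algebra, with Cartan subalgebra ${}^L\mathfrak h\simeq\mathfrak h^*$ (so that the roots of $\mathfrak g$ are the coroots of ${}^L\mathfrak g$), let ${}^L\mathfrak n$ be the sum of its positive root spaces and ${}^L\mathfrak b={}^L\mathfrak h\oplus{}^L\mathfrak n$, and let ${}^LG$ be its adjoint group, ${}^LN\subset{}^LG$ the unipotent subgroup with Lie algebra ${}^L\mathfrak n$. Choose generators $f_i$ of the root spaces of the negative simple roots of ${}^L\mathfrak g$ and put $p_{-1}=\sum_i f_i$. For a ring $R$ of functions in a coordinate $t$ (with derivation $\partial_t$), an ${}^LG$-oper over $R$ is a class of operators $\partial_t+p_{-1}+\mathbf v$, $\mathbf v\in{}^L\mathfrak b(R)$, modulo gauge transformations by ${}^LN(R)$. The Miura transformation sends a Cartan connection $\partial_t+\lambda(t)$ on the ${}^LH$-bundle $\Omega^{-\rho}$,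 $\lambda\in\mathfrak h^*(R)$, to the class of $\partial_t+p_{-1}-\lambda(t)$. An oper is regular at a point $w\in\mathbb C$ if its restriction to the punctured disc, i.e. its image over $\mathbb C((t-w))$, comes from an oper over $\mathbb C[[t-w]]$. Fix pairwise distinct $z_1,\dots,z_N\in\mathbb C$ and $\lambda_1,\dots,\lambda_N\in\mathfrak h^*$. For a finite collection of simple roots $\alpha_{i_1},\dots,\alpha_{i_m}$ ($m\ge 0$), a solution of the Bethe Ansatz equations is a tuple of complex numbers $w_1,\dots,w_m$, pairwise distinct and different from all the $z_i$, such that $$\sum_{i=1}^N\frac{\langle\check\alpha_{i_j},\lambda_i\rangle}{w_j-z_i}-\sum_{s\ne j}\frac{\langle\check\alpha_{i_j},\alpha_{i_s}\rangle}{w_j-w_s}=0,\qquad j=1,\dots,m .$$ Families $(\alpha_{i_j},w_j)_{j=1}^m$ which differ by a simultaneous permutation of the indices $j$ are identified; for $m=0$ there is exactly one (empty) solution. Put $\lambda_\infty=-2\rho-\sum_i\lambda_i+\sum_j\alpha_{i_j}$. Then the assignment $$(\alpha_{i_j},w_j)_{j=1}^m\ \longmapsto\ \partial_t+\lambda(t),\qquad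 \lambda(t)=\sum_{i=1}^N\frac{\lambda_i}{t-z_i}-\sum_{j=1}^m\frac{\alpha_{i_j}}{t-w_j},$$ is a bijection from the set of all solutions of the Bethe Ansatz equations (for all finite collections of simple roots) onto the set of all Cartan connections $\partial_t+\lambda(t)$ with $\lambda(t)$ of this form (for some $m$, some simple roots $\alpha_{i_j}$ and some $w_j$ that are pairwise distinct and different from the $z_i$) whose Miura transformation is an ${}^LG$-oper which is regular at all the points $w_1,\dots,w_m$. Moreover, for every $\lambda_\infty\in\mathfrak h^*$ it restricts to a bijection between the solutions and the connections with this prescribed value of $\lambda_\infty$. -/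

import Mathlib

open scoped TensorProduct

noncomputable section

namespace BetheOper

/-! ### Differential rings: rational functions, the disc and the punctured disc -/

section FractionField

variable {A K : Type*} [CommRing A] [IsDomain A] [Algebra ℂ A] [Field K] [Algebra A K]
  [IsFractionRing A K] [Algebra ℂ K] [IsScalarTower ℂ A K]

/-- The quotient rule `(n / s)' = (n' s - n s') / s²`, for a chosen representation of `x`. -/
def fracDerivFun (d : Derivation ℂ A A) (x : K) : K :=
  let p := IsLocalization.sec (nonZeroDivisors A) x
  algebraMap A K (d p.1 * (p.2 : A) - p.1 * d (p.2 : A)) / algebraMap A K (p.2 : A) ^ 2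

lemma fracDerivFun_div (d : Derivation ℂ A A) (n m : A) (hm : m ≠ 0) :
    fracDerivFun d (algebraMap A K n / algebraMap A K m) =
      algebraMap A K (d n * m - n * d m) / algebraMap A K m ^ 2 := by
  set x : K := algebraMap A K n / algebraMap A K m with hx
  have hinj := IsFractionRing.injective A K
  have hm' : algebraMap A K m ≠ 0 := by simpa using (map_ne_zero_iff _ hinj).2 hm
  have hp := IsLocalization.sec_spec (nonZeroDivisors A) x
  unfold fracDerivFun
  generalize IsLocalization.sec (nonZeroDivisors A) x = p at hp
  obtain ⟨a, s⟩ := p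
  have hs : (s : A) ≠ 0 := nonZeroDivisors.ne_zero s.2
  have hs' : algebraMap A K (s : A) ≠ 0 := (map_ne_zero_iff _ hinj).2 hs
  simp only at hp ⊢
  have h1 : n * (s : A) = a * m := by
    apply hinj
    rw [map_mul, map_mul, ← hp, hx]
    field_simp
  have h2 : n * d (s : A) + (s : A) * d n = a * d m + m * d a := by
    have := congrArg d h1
    simpa only [Derivation.leibniz, smul_eq_mul] using this
  rw [div_eq_div_iff (pow_ne_zero 2 hs') (pow_ne_zero 2 hm'), ← map_pow, ← map_pow, ← map_mul,
    ← map_mul]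
  congr 1
  linear_combination (-(s : A) * m) * h2 + ((s : A) * d m + m * d (s : A)) * h1

/-- The unique extension of a derivation of a domain to its field of fractions. -/
def fracDeriv (d : Derivation ℂ A A) : Derivation ℂ K K where
  toFun := fracDerivFun d
  map_add' x y := by
    obtain ⟨a, b, hb, rfl⟩ := IsFractionRing.div_surjective (A := A) x
    obtain ⟨a', b', hb', rfl⟩ := IsFractionRing.div_surjective (A := A) y
    have hb := nonZeroDivisors.ne_zero hb
    have hb' := nonZeroDivisors.ne_zero hb'
    have hinj := IsFractionRing.injective A K
    have e1 : algebraMap A K b ≠ 0 := (map_ne_zero_iff _ hinj).2 hb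
    have e2 : algebraMap A K b' ≠ 0 := (map_ne_zero_iff _ hinj).2 hb'
    rw [div_add_div _ _ e1 e2, ← map_mul, ← map_mul, ← map_mul, ← map_add,
      fracDerivFun_div d _ _ (mul_ne_zero hb hb'), fracDerivFun_div d _ _ hb,
      fracDerivFun_div d _ _ hb']
    simp only [map_add, map_mul, map_sub, Derivation.leibniz, smul_eq_mul]
    field_simp
    ring
  map_smul' c x := by
    obtain ⟨a, b, hb, rfl⟩ := IsFractionRing.div_surjective (A := A) x
    have hb := nonZeroDivisors.ne_zero hb
    have hc : ∀ u : A, algebraMap A K (c • u) = c • algebraMap A K u := fun u =>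
      map_smul (IsScalarTower.toAlgHom ℂ A K) c u
    have : c • (algebraMap A K a / algebraMap A K b) =
        algebraMap A K (c • a) / algebraMap A K b := by
      rw [hc, smul_div_assoc]
    rw [this, fracDerivFun_div d _ _ hb, fracDerivFun_div d _ _ hb]
    simp only [Derivation.map_smul, smul_mul_assoc, ← smul_sub, hc,
      smul_div_assoc, RingHom.id_apply]
  map_one_eq_zero' := by
    have := fracDerivFun_div (K := K) d 1 1 one_ne_zero
    simpa using this
  leibniz' x y := by
    obtain ⟨a, b, hb, rfl⟩ := IsFractionRing.div_surjective (A := A) x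
    obtain ⟨a', b', hb', rfl⟩ := IsFractionRing.div_surjective (A := A) y
    have hb := nonZeroDivisors.ne_zero hb
    have hb' := nonZeroDivisors.ne_zero hb'
    have hinj := IsFractionRing.injective A K
    have e1 : algebraMap A K b ≠ 0 := (map_ne_zero_iff _ hinj).2 hb
    have e2 : algebraMap A K b' ≠ 0 := (map_ne_zero_iff _ hinj).2 hb'
    change fracDerivFun d _ = _ • fracDerivFun d _ + _ • fracDerivFun d _
    rw [div_mul_div_comm, ← map_mul, ← map_mul,
      fracDerivFun_div d _ _ (mul_ne_zero hb hb'), fracDerivFun_div d _ _ hb,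
      fracDerivFun_div d _ _ hb']
    simp only [map_mul, map_sub, map_add, Derivation.leibniz, smul_eq_mul]
    field_simp
    ring

lemma fracDeriv_div (d : Derivation ℂ A A) (n m : A) (hm : m ≠ 0) :
    fracDeriv d (algebraMap A K n / algebraMap A K m) =
      algebraMap A K (d n * m - n * d m) / algebraMap A K m ^ 2 :=
  fracDerivFun_div d n m hm

lemma fracDeriv_algebraMap (d : Derivation ℂ A A) (a : A) :
    fracDeriv d (algebraMap A K a) = algebraMap A K (d a) := by
  have := fracDeriv_div (K := K) d a 1 one_ne_zero
  simpa using this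

end FractionField

/-- The derivation `d/dt` of the field `ℂ(t)` of rational functions on the projective line. -/
def ratDeriv : Derivation ℂ (RatFunc ℂ) (RatFunc ℂ) :=
  fracDeriv (Polynomial.derivative' (R := ℂ))

/-- The ring `ℂ⟦t⟧` of functions on the formal disc. -/
abbrev DiscRing : Type := PowerSeries ℂ

/-- The field `ℂ((t))` of functions on the punctured formal disc. -/
abbrev PuncturedDiscRing : Type := FractionRing DiscRing

/-- `d/dt` on the formal disc. -/
def discDeriv : Derivation ℂ DiscRing DiscRing := PowerSeries.derivative ℂ

/-- `d/dt` on the punctured formal disc. -/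
def puncturedDeriv : Derivation ℂ PuncturedDiscRing PuncturedDiscRing := fracDeriv discDeriv

/-- The inclusion `ℂ⟦t⟧ → ℂ((t))`. -/
def discToPunctured : DiscRing →ₐ[ℂ] PuncturedDiscRing :=
  IsScalarTower.toAlgHom ℂ DiscRing PuncturedDiscRing

lemma discToPunctured_deriv (r : DiscRing) :
    discToPunctured (discDeriv r) = puncturedDeriv (discToPunctured r) :=
  (fracDeriv_algebraMap discDeriv r).symm

/-- The Taylor expansion of a polynomial at `w`, in the local coordinate `t - w`. -/
def taylorAt (w : ℂ) : Polynomial ℂ →ₐ[ℂ] PuncturedDiscRing :=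
  discToPunctured.comp
    ((Polynomial.coeToPowerSeries.algHom ℂ).comp (Polynomial.taylorAlgHom w))

lemma taylorAt_apply (w : ℂ) (p : Polynomial ℂ) :
    taylorAt w p = algebraMap DiscRing PuncturedDiscRing (Polynomial.taylor w p : Polynomial ℂ) := by
  simp [taylorAt, discToPunctured]

lemma taylorAt_injective (w : ℂ) : Function.Injective (taylorAt w) := by
  intro p q h
  rw [taylorAt_apply, taylorAt_apply] at h
  have h := IsFractionRing.injective DiscRing PuncturedDiscRing h
  exact Polynomial.taylor_injective w (Polynomial.coe_injective ℂ h)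

/-- The Laurent expansion of a rational function at `w`, in the local coordinate `t - w`. -/
def expandAt (w : ℂ) : RatFunc ℂ →ₐ[ℂ] PuncturedDiscRing :=
  IsFractionRing.liftAlgHom (taylorAt_injective w)

lemma taylorAt_deriv (w : ℂ) (p : Polynomial ℂ) :
    taylorAt w (Polynomial.derivative' p) = puncturedDeriv (taylorAt w p) := by
  rw [taylorAt_apply, taylorAt_apply, puncturedDeriv, fracDeriv_algebraMap]
  congr 1
  rw [discDeriv, PowerSeries.derivative_coe]
  congr 1
  simp [Polynomial.derivative', Polynomial.taylor_apply, Polynomial.derivative_comp]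

lemma expandAt_deriv (w : ℂ) (f : RatFunc ℂ) :
    expandAt w (ratDeriv f) = puncturedDeriv (expandAt w f) := by
  have key : ∀ p : Polynomial ℂ,
      expandAt w (algebraMap (Polynomial ℂ) (RatFunc ℂ) p) = taylorAt w p := fun p => by
    simp [expandAt]
  obtain ⟨a, b, hb, rfl⟩ := IsFractionRing.div_surjective (A := Polynomial ℂ) f
  have hb := nonZeroDivisors.ne_zero hb
  have hb' : taylorAt w b ≠ 0 := (map_ne_zero_iff _ (taylorAt_injective w)).2 hb
  have h1 : puncturedDeriv (taylorAt w a) =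
      puncturedDeriv ((taylorAt w a / taylorAt w b) * taylorAt w b) := by
    rw [div_mul_cancel₀ _ hb']
  rw [Derivation.leibniz, smul_eq_mul, smul_eq_mul, ← taylorAt_deriv, ← taylorAt_deriv] at h1
  rw [ratDeriv, fracDeriv_div _ _ _ hb, map_div₀, map_div₀, map_pow, key, key, key, map_sub,
    map_mul, map_mul]
  field_simp at h1 ⊢
  linear_combination h1

/-! ### Opers over a differential ring -/

section Gauge

variable {R : Type*} [CommRing R] [Algebra ℂ R] {S : Type*} [CommRing S] [Algebra ℂ S]
  {L : Type*} [LieRing L] [LieAlgebra ℂ L]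

/-- The connection operator `∂ + A`, for `A ∈ L(R) = R ⊗ L`, acting on `L(R)` through the adjoint
representation. For `L` semisimple the adjoint representation is faithful, so that the operator
determines `A`. -/
def connectionOperator (d : Derivation ℂ R R) (A : R ⊗[ℂ] L) : Module.End ℂ (R ⊗[ℂ] L) :=
  LinearMap.rTensor L (d : R →ₗ[ℂ] R) + (LieAlgebra.ad R (R ⊗[ℂ] L) A).restrictScalars ℂ

variable (R) in
/-- The group `N(R)` of `R`-points of the unipotent subgroup with Lie algebra `n` of the adjoint
group of `L`, in the adjoint representation: it is generated by the exponentials of the (nilpotent)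
operators `ad x`, `x ∈ n(R)`. -/
def unipotentGroup (n : Submodule ℂ L) : Subgroup ((R ⊗[ℂ] L) ≃ₗ[R] (R ⊗[ℂ] L)) :=
  Subgroup.closure {g | ∃ x ∈ n.baseChange R, ∃ k : ℕ, LieAlgebra.ad R (R ⊗[ℂ] L) x ^ k = 0 ∧
    (g : Module.End R (R ⊗[ℂ] L)) =
      ∑ i ∈ Finset.range k, (i.factorial : ℂ)⁻¹ • LieAlgebra.ad R (R ⊗[ℂ] L) x ^ i}

/-- `∂ + A'` is the gauge transform `g (∂ + A) g⁻¹` of `∂ + A` by some `g ∈ N(R)`. -/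
def GaugeEquiv (d : Derivation ℂ R R) (n : Submodule ℂ L) (A A' : R ⊗[ℂ] L) : Prop :=
  ∃ g ∈ unipotentGroup R n, ∀ v, g (connectionOperator d A v) = connectionOperator d A' (g v)

/-- The data in a Lie algebra needed to define opers: a Borel subalgebra `𝔟`, its nilradical `𝔫`
and the element `p₋₁ = ∑ fᵢ`, the sum of generators of the simple negative root spaces. -/
structure OperFrame (L : Type*) [LieRing L] [LieAlgebra ℂ L] where
  borel : Submodule ℂ L
  nilradical : Submodule ℂ L
  pMinusOne : L

/-- The operators `∂ + p₋₁ + v` with `v ∈ 𝔟(R)`. -/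
def OperForm (R : Type*) [CommRing R] [Algebra ℂ R] (F : OperFrame L) : Type _ :=
  {A : R ⊗[ℂ] L // A - 1 ⊗ₜ[ℂ] F.pMinusOne ∈ F.borel.baseChange R}

/-- Gauge equivalence under `N(R)`. -/
def operSetoid (d : Derivation ℂ R R) (F : OperFrame L) : Setoid (OperForm R F) where
  r A A' := GaugeEquiv d F.nilradical A.1 A'.1
  iseqv :=
    { refl := fun _ => ⟨1, one_mem _, fun _ => rfl⟩
      symm := by
        rintro A A' ⟨g, hg, h⟩
        refine ⟨g⁻¹, inv_mem hg, fun v => ?_⟩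
        apply g.injective
        change g (g.symm _) = g (connectionOperator d A.1 (g.symm v))
        rw [h]
        simp
      trans := by
        rintro A A' A'' ⟨g, hg, h⟩ ⟨g', hg', h'⟩
        refine ⟨g' * g, mul_mem hg' hg, fun v => ?_⟩
        change g' (g _) = connectionOperator d A''.1 (g' (g v))
        rw [h, h'] }

/-- The space of opers on `Spec R` (with global coordinate `t`, `∂ = ∂_t`): operators
`∂ + p₋₁ + v`, `v ∈ 𝔟(R)`, up to the gauge action of `N(R)`. -/
def Oper (d : Derivation ℂ R R) (F : OperFrame L) : Type _ := Quotient (operSetoid d F)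

/-- The map `L(R) → L(S)` induced by a ring homomorphism. -/
def changeRing (L : Type*) [LieRing L] [LieAlgebra ℂ L] (φ : R →ₐ[ℂ] S) :
    R ⊗[ℂ] L →ₗ[ℂ] S ⊗[ℂ] L := LinearMap.rTensor L φ.toLinearMap

@[simp] lemma changeRing_tmul (φ : R →ₐ[ℂ] S) (r : R) (l : L) :
    changeRing L φ (r ⊗ₜ l) = φ r ⊗ₜ l := rfl

lemma changeRing_smul (φ : R →ₐ[ℂ] S) (r : R) (x : R ⊗[ℂ] L) :
    changeRing L φ (r • x) = φ r • changeRing L φ x := by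
  induction x with
  | zero => simp
  | tmul a l => simp [TensorProduct.smul_tmul']
  | add x y hx hy => simp only [smul_add, map_add, hx, hy]

lemma changeRing_lie (φ : R →ₐ[ℂ] S) (x y : R ⊗[ℂ] L) :
    changeRing L φ ⁅x, y⁆ = ⁅changeRing L φ x, changeRing L φ y⁆ := by
  induction x with
  | zero => simp
  | tmul a l =>
    induction y with
    | zero => simp
    | tmul b m => simp
    | add x y hx hy => simp only [lie_add, map_add, hx, hy]
  | add x y hx hy => simp only [add_lie, map_add, hx, hy]

lemma changeRing_mem_baseChange (φ : R →ₐ[ℂ] S) (n : Submodule ℂ L) {x : R ⊗[ℂ] L}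
    (hx : x ∈ n.baseChange R) : changeRing L φ x ∈ n.baseChange S := by
  rw [Submodule.baseChange_eq_span] at hx
  induction hx using Submodule.span_induction with
  | mem x h =>
    obtain ⟨l, hl, rfl⟩ := h
    exact Submodule.tmul_mem_baseChange_of_mem _ hl
  | zero => simp
  | add x y _ _ hx hy => rw [map_add]; exact add_mem hx hy
  | smul r x _ hx => rw [changeRing_smul]; exact Submodule.smul_mem _ _ hx

lemma changeRing_ext (φ : R →ₐ[ℂ] S) {f g : S ⊗[ℂ] L →+ S ⊗[ℂ] L}
    (h : ∀ (s : S) (x : R ⊗[ℂ] L), f (s • changeRing L φ x) = g (s • changeRing L φ x)) : f = g := by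
  ext v
  induction v with
  | zero => simp
  | tmul s l => simpa [TensorProduct.smul_tmul'] using h s (1 ⊗ₜ l)
  | add x y hx hy => rw [map_add, map_add, hx, hy]

lemma exp_mul_exp_neg {E : Type*} [Ring E] [Algebra ℂ E] (a : E) (k : ℕ) (ha : a ^ k = 0) :
    (∑ i ∈ Finset.range k, (i.factorial : ℂ)⁻¹ • a ^ i) *
      (∑ i ∈ Finset.range k, (i.factorial : ℂ)⁻¹ • (-a) ^ i) = 1 := by
  let : Module ℚ E := Module.compHom E (algebraMap ℚ ℂ)
  have key : ∀ (c : E), c ^ k = 0 →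
      ∑ i ∈ Finset.range k, (i.factorial : ℂ)⁻¹ • c ^ i = IsNilpotent.exp c := by
    intro c hc
    rw [IsNilpotent.exp_eq_sum hc]
    refine Finset.sum_congr rfl fun i _ => ?_
    change _ = (algebraMap ℚ ℂ (i.factorial : ℚ)⁻¹) • c ^ i
    simp
  rw [key a ha, key (-a) (by rw [neg_pow, ha, mul_zero])]
  exact IsNilpotent.exp_mul_exp_neg_self ⟨k, ha⟩

lemma changeRing_unipotentGroup (φ : R →ₐ[ℂ] S) (n : Submodule ℂ L)
    (g : (R ⊗[ℂ] L) ≃ₗ[R] (R ⊗[ℂ] L)) (hg : g ∈ unipotentGroup R n) :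
    ∃ g' ∈ unipotentGroup S n, ∀ x, g' (changeRing L φ x) = changeRing L φ (g x) := by
  induction hg using Subgroup.closure_induction with
  | mem g hg =>
    obtain ⟨x, hx, k, hk, hg⟩ := hg
    have hpow : ∀ (i : ℕ) (v : R ⊗[ℂ] L),
        (LieAlgebra.ad S (S ⊗[ℂ] L) (changeRing L φ x) ^ i) (changeRing L φ v) =
          changeRing L φ ((LieAlgebra.ad R (R ⊗[ℂ] L) x ^ i) v) := by
      intro i
      induction i with
      | zero => simp
      | succ i ih =>
        intro v
        rw [pow_succ, pow_succ, Module.End.mul_apply, Module.End.mul_apply, LieAlgebra.ad_apply,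
          LieAlgebra.ad_apply, ← changeRing_lie, ih]
    set a := LieAlgebra.ad S (S ⊗[ℂ] L) (changeRing L φ x) with ha
    have hak : a ^ k = 0 := by
      have : (a ^ k : Module.End S (S ⊗[ℂ] L)).toAddMonoidHom =
          (0 : Module.End S (S ⊗[ℂ] L)).toAddMonoidHom := by
        apply changeRing_ext φ
        intro s v
        simp [hpow, hk]
      ext v
      exact DFunLike.congr_fun this _
    have e1 := exp_mul_exp_neg a k hak
    have e2 := exp_mul_exp_neg (-a) k (by rw [neg_pow, hak, mul_zero])
    rw [neg_neg] at e2
    refine ⟨LinearEquiv.ofLinearMap _ _ e1 e2, Subgroup.subset_closure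
      ⟨_, changeRing_mem_baseChange φ n hx, k, hak, rfl⟩, fun v => ?_⟩
    have hgv : g v = (∑ i ∈ Finset.range k, (i.factorial : ℂ)⁻¹ •
        LieAlgebra.ad R (R ⊗[ℂ] L) x ^ i) v := by rw [← hg]; rfl
    rw [hgv]
    simp [hpow, LinearMap.sum_apply]
  | one => exact ⟨1, one_mem _, fun _ => rfl⟩
  | mul g h _ _ ihg ihh =>
    obtain ⟨g', hg', eg⟩ := ihg
    obtain ⟨h', hh', eh⟩ := ihh
    exact ⟨g' * h', mul_mem hg' hh', fun x => by
      change g' (h' _) = changeRing L φ (g (h x))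
      rw [eh, eg]⟩
  | inv g _ ih =>
    obtain ⟨g', hg', eg⟩ := ih
    refine ⟨g'⁻¹, inv_mem hg', fun x => ?_⟩
    apply g'.injective
    rw [eg]
    change g' (g'.symm _) = changeRing L φ (g (g.symm x))
    simp

lemma connectionOperator_smul (d : Derivation ℂ R R) (A : R ⊗[ℂ] L) (r : R) (v : R ⊗[ℂ] L) :
    connectionOperator d A (r • v) = d r • v + r • connectionOperator d A v := by
  have h : LinearMap.rTensor L (d : R →ₗ[ℂ] R) (r • v) =
      d r • v + r • LinearMap.rTensor L (d : R →ₗ[ℂ] R) v := by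
    induction v with
    | zero => simp
    | tmul a l =>
      simp [TensorProduct.smul_tmul', ← TensorProduct.add_tmul, mul_comm, add_comm]
    | add x y hx hy => simp only [smul_add, map_add, hx, hy]; abel
  simp [connectionOperator, h, add_assoc]

lemma changeRing_connectionOperator {d : Derivation ℂ R R} {d' : Derivation ℂ S S}
    (φ : R →ₐ[ℂ] S) (hφ : ∀ r, φ (d r) = d' (φ r)) (A v : R ⊗[ℂ] L) :
    changeRing L φ (connectionOperator d A v) =
      connectionOperator d' (changeRing L φ A) (changeRing L φ v) := by
  have h : changeRing L φ (LinearMap.rTensor L (d : R →ₗ[ℂ] R) v) =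
      LinearMap.rTensor L (d' : S →ₗ[ℂ] S) (changeRing L φ v) := by
    induction v with
    | zero => simp
    | tmul a l => simp [hφ]
    | add x y hx hy => simp only [map_add, hx, hy]
  simp [connectionOperator, h, changeRing_lie]

lemma GaugeEquiv.changeRing {d : Derivation ℂ R R} {d' : Derivation ℂ S S}
    (φ : R →ₐ[ℂ] S) (hφ : ∀ r, φ (d r) = d' (φ r)) {n : Submodule ℂ L} {A A' : R ⊗[ℂ] L}
    (h : GaugeEquiv d n A A') :
    GaugeEquiv d' n (changeRing L φ A) (changeRing L φ A') := by
  obtain ⟨g, hg, h⟩ := h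
  obtain ⟨g', hg', e⟩ := changeRing_unipotentGroup φ n g hg
  refine ⟨g', hg', fun v => ?_⟩
  have : (g'.toLinearMap.toAddMonoidHom.comp
      (connectionOperator d' (BetheOper.changeRing L φ A)).toAddMonoidHom) =
      ((connectionOperator d' (BetheOper.changeRing L φ A')).toAddMonoidHom.comp
        g'.toLinearMap.toAddMonoidHom) := by
    apply changeRing_ext φ
    intro s x
    simp only [AddMonoidHom.comp_apply, LinearMap.toAddMonoidHom_coe, LinearEquiv.coe_coe,
      connectionOperator_smul, map_add, map_smul]
    rw [← changeRing_connectionOperator φ hφ, e, e, h, changeRing_connectionOperator φ hφ]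
  exact DFunLike.congr_fun this v

/-- The operator over `S` obtained from one over `R` by a ring homomorphism. -/
def OperForm.map (φ : R →ₐ[ℂ] S) {F : OperFrame L} (A : OperForm R F) : OperForm S F :=
  ⟨changeRing L φ A.1, by
    have := changeRing_mem_baseChange φ _ A.2
    simpa using this⟩

/-- Restriction (pull-back) of opers along a homomorphism of differential rings. -/
def Oper.map {d : Derivation ℂ R R} {d' : Derivation ℂ S S} {F : OperFrame L}
    (φ : R →ₐ[ℂ] S) (hφ : ∀ r, φ (d r) = d' (φ r)) : Oper d F → Oper d' F :=
  Quotient.map' (OperForm.map φ) fun _ _ h => GaugeEquiv.changeRing φ hφ h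

/-- An oper on the punctured disc is regular if it lies in the image of the opers on the disc. -/
def Oper.IsRegular {F : OperFrame L} (τ : Oper puncturedDeriv F) : Prop :=
  τ ∈ Set.range (Oper.map (d := discDeriv) (F := F) discToPunctured discToPunctured_deriv)

/-- The restriction of a rational oper to the punctured disc at `w`, with coordinate `t - w`. -/
def Oper.restrictAt {F : OperFrame L} (τ : Oper ratDeriv F) (w : ℂ) : Oper puncturedDeriv F :=
  Oper.map (expandAt w) (expandAt_deriv w) τ

end Gauge

/-! ### The Langlands dual Lie algebra, Cartan connections and the Miura transformation -/

section Miura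

open LieAlgebra LieAlgebra.IsKilling Module

variable {𝔤 : Type*} [LieRing 𝔤] [LieAlgebra ℂ 𝔤] [FiniteDimensional ℂ 𝔤]
  [LieAlgebra.IsSimple ℂ 𝔤] {𝔥 : LieSubalgebra ℂ 𝔤} [𝔥.IsCartanSubalgebra]
  {𝔤L : Type*} [LieRing 𝔤L] [LieAlgebra ℂ 𝔤L] [FiniteDimensional ℂ 𝔤L]
  [LieAlgebra.IsSimple ℂ 𝔤L] {𝔥L : LieSubalgebra ℂ 𝔤L} [𝔥L.IsCartanSubalgebra]

variable (𝔥 𝔥L) in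
/-- An identification of `(𝔤L, 𝔥L)` as the Langlands dual of `(𝔤, 𝔥)`: an isomorphism of the root
system of `(𝔤, 𝔥)` with the dual of the root system of `(𝔤L, 𝔥L)`, that is an isomorphism
`𝔥* ≃ 𝔥L` carrying the roots of `𝔤` to the coroots of `𝔤L`, whose transpose `𝔥L* ≃ 𝔥` carries the
corresponding roots of `𝔤L` to the coroots of `𝔤`. -/
abbrev LanglandsDuality : Type _ := RootPairing.Equiv (rootSystem 𝔥) (rootSystem 𝔥L).flip

variable (D : LanglandsDuality 𝔥 𝔥L) (b : (rootSystem 𝔥).Base)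

/-- The root of the dual Lie algebra which corresponds to the coroot of the root `i` of `𝔤`. -/
def LanglandsDuality.dualRoot (i : 𝔥.root) : LieModule.Weight ℂ 𝔥L 𝔤L := (D.indexEquiv i).1

/-- The identification `𝔥* ≃ 𝔥L`. -/
def LanglandsDuality.toCartan : Dual ℂ 𝔥 →ₗ[ℂ] 𝔤L :=
  𝔥L.toSubmodule.subtype ∘ₗ D.weightMap

/-- The sum `𝔫` of the positive root spaces of the dual Lie algebra. -/
def LanglandsDuality.dualNilradical : Submodule ℂ 𝔤L :=
  ⨆ (i : 𝔥.root) (_ : b.IsPos i), (rootSpace 𝔥L (D.dualRoot i)).toSubmodule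

/-- The data defining `ᴸG`-opers: `𝔟 = 𝔥L ⊕ 𝔫`, `𝔫` and `p₋₁ = ∑ fᵢ`. -/
def LanglandsDuality.operFrame (f : b.support → 𝔤L) : OperFrame 𝔤L where
  borel := 𝔥L.toSubmodule ⊔ D.dualNilradical b
  nilradical := D.dualNilradical b
  pMinusOne := ∑ i, f i

/-- `f` is a choice of generators of the root spaces of the negative simple roots. -/
def LanglandsDuality.IsNegGenerators (f : b.support → 𝔤L) : Prop :=
  ∀ i : b.support, f i ≠ 0 ∧ f i ∈ rootSpace 𝔥L (-(⇑(D.dualRoot i) : 𝔥L → ℂ))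

/-- A connection on the `ᴸH`-bundle `Ω^{-ρ}` over `Spec R`, written in the trivialization given by
the coordinate `t` as the operator `∂_t + coeff`, `coeff ∈ 𝔥*(R) = 𝔥L(R)`. -/
@[ext] structure CartanConnection (R : Type*) [CommRing R] [Algebra ℂ R]
    (𝔥 : LieSubalgebra ℂ 𝔤) where
  coeff : R ⊗[ℂ] Dual ℂ 𝔥

variable {R : Type*} [CommRing R] [Algebra ℂ R]

/-- The Miura transformation: the connection `∂_t + λ` on `Ω^{-ρ}` is sent to the oper which is
the class of `∂_t + p₋₁ - λ` (here `∂_t - λ` is the dual connection on `Ω^ρ`). -/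
def miura (f : b.support → 𝔤L) (d : Derivation ℂ R R) (c : CartanConnection R 𝔥) :
    Oper d (D.operFrame b f) :=
  Quotient.mk _ ⟨1 ⊗ₜ[ℂ] (D.operFrame b f).pMinusOne
    - LinearMap.lTensor R D.toCartan c.coeff, by
      rw [sub_sub_cancel_left]
      apply Submodule.neg_mem
      generalize c.coeff = x
      induction x with
      | zero => simp
      | tmul r l =>
        rw [LinearMap.lTensor_tmul]
        apply Submodule.tmul_mem_baseChange_of_mem
        exact Submodule.mem_sup_left (D.weightMap l).2
      | add x y hx hy => rw [map_add]; exact add_mem hx hy⟩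

/-! ### The Bethe Ansatz -/

variable {N : ℕ} (z : Fin N → ℂ) (lam : Fin N → Dual ℂ 𝔥)

/-- A finite family of pairwise distinct points `w_1, …, w_m` of `ℂ`, different from the `z_i`, with
a simple root `α_{i_j}` of `𝔤` attached to each `w_j`. -/
structure ColouredPoints where
  m : ℕ
  colour : Fin m → b.support
  w : Fin m → ℂ
  w_injective : Function.Injective w
  w_ne : ∀ j i, w j ≠ z i

namespace ColouredPoints

variable {b z}

/-- The simple root `α_{i_j}`. -/
def simpleRoot (s : ColouredPoints b z) (j : Fin s.m) : Dual ℂ 𝔥 :=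
  (rootSystem 𝔥).root (s.colour j)

/-- The simple coroot `α̌_{i_j}`. -/
def simpleCoroot (s : ColouredPoints b z) (j : Fin s.m) : 𝔥 :=
  (rootSystem 𝔥).coroot (s.colour j)

/-- The Bethe Ansatz equations. -/
def BetheEquations (s : ColouredPoints b z) : Prop :=
  ∀ j : Fin s.m, ∑ i, lam i (s.simpleCoroot j) / (s.w j - z i)
    - ∑ k ∈ Finset.univ.erase j, s.simpleRoot k (s.simpleCoroot j) / (s.w j - s.w k) = 0

/-- The connection `∂_t + λ(t)`, `λ(t) = ∑ λ_i / (t - z_i) - ∑ α_{i_j} / (t - w_j)`. -/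
def connection (s : ColouredPoints b z) : CartanConnection (RatFunc ℂ) 𝔥 where
  coeff := ∑ i, (RatFunc.X - RatFunc.C (z i))⁻¹ ⊗ₜ[ℂ] lam i
    - ∑ j, (RatFunc.X - RatFunc.C (s.w j))⁻¹ ⊗ₜ[ℂ] s.simpleRoot j

/-- Two families are the same up to the permutations which respect the attached simple roots. -/
instance setoid : Setoid (ColouredPoints b z) where
  r s s' := ∃ σ : Fin s.m ≃ Fin s'.m, (∀ j, s'.colour (σ j) = s.colour j) ∧
    ∀ j, s'.w (σ j) = s.w j
  iseqv :=
    { refl := fun s => ⟨Equiv.refl _, fun _ => rfl, fun _ => rfl⟩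
      symm := fun ⟨σ, h, h'⟩ => ⟨σ.symm, fun j => by rw [← h]; simp, fun j => by rw [← h']; simp⟩
      trans := fun ⟨σ, h, h'⟩ ⟨τ, k, k'⟩ => ⟨σ.trans τ, fun j => by simp [h, k],
        fun j => by simp [h', k']⟩ }

end ColouredPoints

/-- The half-sum `ρ` of the positive roots of `𝔤`. -/
def rho : Dual ℂ 𝔥 :=
  open scoped Classical in
  (2 : ℂ)⁻¹ • ∑ i ∈ Finset.univ.filter (fun i : 𝔥.root => b.IsPos i), (rootSystem 𝔥).root i

/-- The residue `λ_∞ = - ∑ λ_i + ∑ α_{i_j} - 2ρ` of `∂_t + λ(t)` at infinity. -/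
def ColouredPoints.lamInfty {b : (rootSystem 𝔥).Base} {z : Fin N → ℂ} (s : ColouredPoints b z) :
    Dual ℂ 𝔥 :=
  -∑ i, lam i + ∑ j, s.simpleRoot j - (2 : ℂ) • rho b

/-- Finite families of points with attached simple roots, up to permutations. -/
def Configuration : Type _ := Quotient (ColouredPoints.setoid (b := b) (z := z))

/-- The connection `∂_t + λ(t)` attached to a configuration. -/
def Configuration.connection {b : (rootSystem 𝔥).Base} {z : Fin N → ℂ} (lam : Fin N → Dual ℂ 𝔥) :
    Configuration b z → CartanConnection (RatFunc ℂ) 𝔥 :=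
  Quotient.lift (fun s => s.connection lam) (by
    rintro s s' ⟨σ, h, h'⟩
    simp only [ColouredPoints.connection, ColouredPoints.simpleRoot]
    rw [← Equiv.sum_comp σ]
    simp only [h, h'])

/-- The solutions of the Bethe Ansatz equations, up to permutations, for all collections of simple
roots (including the empty one). -/
def betheSolutions : Set (Configuration b z) :=
  {x | ∃ s : ColouredPoints b z, Quotient.mk _ s = x ∧ s.BetheEquations lam}

/-- The solutions for the collections of simple roots with prescribed `λ_∞`. -/
def betheSolutionsAt (lamInf : Dual ℂ 𝔥) : Set (Configuration b z) :=
  {x | ∃ s : ColouredPoints b z, Quotient.mk _ s = x ∧ s.BetheEquations lam ∧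
    s.lamInfty lam = lamInf}

/-- The connections `∂_t + λ(t)` of the form `λ(t) = ∑ λ_i / (t - z_i) - ∑ α_{i_j} / (t - w_j)`
whose Miura transformation is an oper which is regular at all the points `w_j`. -/
def genericConnections (f : b.support → 𝔤L) : Set (CartanConnection (RatFunc ℂ) 𝔥) :=
  {c | ∃ s : ColouredPoints b z, c = s.connection lam ∧
    ∀ j, ((miura D b f ratDeriv c).restrictAt (s.w j)).IsRegular}

/-- The connections as above with prescribed residue `λ_∞` at infinity. -/
def genericConnectionsAt (f : b.support → 𝔤L) (lamInf : Dual ℂ 𝔥) :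
    Set (CartanConnection (RatFunc ℂ) 𝔥) :=
  {c | ∃ s : ColouredPoints b z, c = s.connection lam ∧ s.lamInfty lam = lamInf ∧
    ∀ j, ((miura D b f ratDeriv c).restrictAt (s.w j)).IsRegular}

end Miura

end BetheOper

end

/-!
Near a point `w = w_j` the Miura transformation of `∂_t + λ(t)` is, in the coordinate `t - w`,

  `∂ + p₋₁ + t⁻¹ h - u(t)`,  `u ∈ 𝔥L⟦t⟧`,

where `h` is the coroot of `ᴸ𝔤` corresponding to the simple root `α_{i_j}` of `𝔤`, and the left-hand
side of the `j`-th Bethe Ansatz equation is `α(u(0))`, for `α` the root of `ᴸ𝔤` corresponding to the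
coroot `α̌_{i_j}`. So the theorem is the local statement that this oper is regular if and only if
`α(u(0)) = 0` (`isRegular_mk_iff`).

Choose `e` in the root space of `α` with `[e, p₋₁] = h` (`exists_posGenerator`). The gauge
transformation by `exp (-t⁻¹ e)` turns the operator into `∂ + p₋₁ - u - t⁻¹ α(u) e`
(`gaugeEquiv_of_sl2`), which is visibly regular if `α(u(0)) = 0`. In general it has a simple pole
with the nilpotent residue `-α(u(0)) e`. If it is gauge equivalent to a regular operator, then its
monodromy in the adjoint representation is trivial, and the residue has to vanish
(`ad_eq_zero_of_gaugeEquiv_regular`). The monodromy is treated algebraically: the regular operator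
has a full space of formal horizontal sections, these are carried to horizontal sections of the
singular operator, and by the recursion for their coefficients the leading coefficients fill a
subspace of the centralizer of the residue; by equality of dimensions it is all of `ᴸ𝔤`.

That the connection determines the family of points with their simple roots, up to permutation, is
seen from the poles and residues of `λ(t)` away from the `z_i`
(`Configuration.connection_injective`).
-/

open scoped TensorProduct

noncomputable section

namespace BetheOper

/-! ### Conjugation by exponentials of nilpotent elements -/

section Exponential

variable {E : Type*} [Ring E] [Algebra ℂ E] {X T B C : E}

lemma pow_mul_of_commutators (hB : X * T = T * X + B) (hC : X * B = B * X + C)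
    (h0 : X * C = C * X) (n : ℕ) :
    X ^ (n + 2) * T = T * X ^ (n + 2) + ((n : ℂ) + 2) • (B * X ^ (n + 1)) +
      (((n : ℂ) + 2) * (n + 1) / 2) • (C * X ^ n) := by
  induction n with
  | zero =>
    have : X ^ 2 * T = X * (X * T) := by rw [pow_two, mul_assoc]
    simp only [zero_add, this, hB, mul_add, ← mul_assoc, hC]
    simp only [pow_two, pow_one, pow_zero, mul_one, add_mul, mul_assoc]
    push_cast
    norm_num
    rw [two_smul]
    abel
  | succ n ih =>
    have e : X ^ (n + 1 + 2) * T = X * (X ^ (n + 2) * T) := by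
      rw [← mul_assoc, ← pow_succ']
    have h1 : X * (T * X ^ (n + 2)) = T * X ^ (n + 3) + B * X ^ (n + 2) := by
      rw [← mul_assoc, hB, add_mul, mul_assoc, ← pow_succ']
    have h2 : X * (B * X ^ (n + 1)) = B * X ^ (n + 2) + C * X ^ (n + 1) := by
      rw [← mul_assoc, hC, add_mul, mul_assoc, ← pow_succ']
    have h3 : X * (C * X ^ n) = C * X ^ (n + 1) := by
      rw [← mul_assoc, h0, mul_assoc, ← pow_succ']
    rw [e, ih, mul_add, mul_add, mul_smul_comm, mul_smul_comm, h1, h2, h3]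
    push_cast
    module

/-- Conjugation by the exponential of a nilpotent `X` when the third commutator with `X` vanishes.
The sum is taken up to `k + 2` so that shifting the summation index by two loses only terms with
`X ^ k = 0`. -/
lemma exp_mul_of_commutators {k : ℕ} (hX : X ^ k = 0) (hB : X * T = T * X + B)
    (hC : X * B = B * X + C) (h0 : X * C = C * X) :
    (∑ i ∈ Finset.range (k + 2), (i.factorial : ℂ)⁻¹ • X ^ i) * T =
      (T + B + (2 : ℂ)⁻¹ • C) * ∑ i ∈ Finset.range (k + 2), (i.factorial : ℂ)⁻¹ • X ^ i := by
  set a : ℕ → E := fun i => (i.factorial : ℂ)⁻¹ • X ^ i with ha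
  have hak : a k = 0 := by simp [ha, hX]
  have hak' : a (k + 1) = 0 := by simp [ha, pow_succ, hX]
  have hrec (n : ℕ) : a (n + 2) * T = T * a (n + 2) + B * a (n + 1) + ((2 : ℂ)⁻¹ • C) * a n := by
    simp only [ha, smul_mul_assoc, mul_smul_comm, pow_mul_of_commutators hB hC h0 n, smul_add,
      smul_smul, Nat.factorial_succ]
    have : (n.factorial : ℂ) ≠ 0 := by exact_mod_cast n.factorial_ne_zero
    have h1 : (n : ℂ) + 1 ≠ 0 := by exact_mod_cast n.succ_ne_zero
    have h2 : (n : ℂ) + 1 + 1 ≠ 0 := by exact_mod_cast (n + 1).succ_ne_zero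
    push_cast
    congr 2
    · congr 1
      field_simp
      ring
    · field_simp
      ring
  have e0 : a 0 = 1 := by simp [ha]
  have e1 : a 1 = X := by simp [ha]
  have s2 : ∑ i ∈ Finset.range (k + 2), a i = ∑ i ∈ Finset.range k, a (i + 2) + X + 1 := by
    rw [Finset.sum_range_succ', Finset.sum_range_succ', e0, e1]
  have s1 : ∑ i ∈ Finset.range (k + 2), a i = ∑ i ∈ Finset.range k, a (i + 1) + 1 := by
    rw [Finset.sum_range_succ, hak', add_zero, Finset.sum_range_succ', e0]
  have s0 : ∑ i ∈ Finset.range (k + 2), a i = ∑ i ∈ Finset.range k, a i := by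
    rw [Finset.sum_range_succ, hak', add_zero, Finset.sum_range_succ, hak, add_zero]
  change (∑ i ∈ Finset.range (k + 2), a i) * T = _ * ∑ i ∈ Finset.range (k + 2), a i
  rw [add_mul, add_mul]
  nth_rw 3 [s1]
  nth_rw 3 [s0]
  rw [s2]
  simp only [add_mul, mul_add, Finset.sum_mul, Finset.mul_sum, hrec, Finset.sum_add_distrib, hB,
    one_mul, mul_one]
  abel

end Exponential

/-! ### Gauge transformations by exponentials -/

section Gauge

variable {R : Type*} [CommRing R] [Algebra ℂ R] {L : Type*} [LieRing L] [LieAlgebra ℂ L]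

lemma rTensor_derivation_lie (d : Derivation ℂ R R) (x y : R ⊗[ℂ] L) :
    LinearMap.rTensor L (d : R →ₗ[ℂ] R) ⁅x, y⁆ =
      ⁅LinearMap.rTensor L (d : R →ₗ[ℂ] R) x, y⁆ + ⁅x, LinearMap.rTensor L (d : R →ₗ[ℂ] R) y⁆ := by
  induction x with
  | zero => simp
  | tmul a l =>
    induction y with
    | zero => simp
    | tmul b m => simp [TensorProduct.add_tmul, mul_comm, add_comm]
    | add x y hx hy => simp only [lie_add, map_add, hx, hy]; abel
  | add x y hx hy => simp only [add_lie, map_add, hx, hy]; abel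

/-- The gauge action of `exp x` on `∂ + A`, when the series
`A + [x, A] - ∂x + [x, [x, A] - ∂x] / 2 + ⋯` stops after the quadratic term. -/
lemma gaugeEquiv_exp (d : Derivation ℂ R R) (n : Submodule ℂ L) {x A B : R ⊗[ℂ] L}
    (hx : x ∈ n.baseChange R) (hnil : IsNilpotent (LieAlgebra.ad R (R ⊗[ℂ] L) x))
    (hB : B = ⁅x, A⁆ - LinearMap.rTensor L (d : R →ₗ[ℂ] R) x) (h3 : ⁅x, ⁅x, B⁆⁆ = 0) :
    GaugeEquiv d n A (A + B + (2 : ℂ)⁻¹ • ⁅x, B⁆) := by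
  obtain ⟨k, hk⟩ := hnil
  set a := LieAlgebra.ad R (R ⊗[ℂ] L) x with ha
  have hk2 : a ^ (k + 2) = 0 := by rw [pow_add, hk, zero_mul]
  have e1 := exp_mul_exp_neg a (k + 2) hk2
  have e2 := exp_mul_exp_neg (-a) (k + 2) (by rw [neg_pow, hk2, mul_zero])
  rw [neg_neg] at e2
  refine ⟨LinearEquiv.ofLinearMap _ _ e1 e2,
    Subgroup.subset_closure ⟨x, hx, k + 2, hk2, rfl⟩, fun v => ?_⟩
  set r : Module.End R (R ⊗[ℂ] L) → Module.End ℂ (R ⊗[ℂ] L) := fun u => u.restrictScalars ℂ with hr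
  have hpow (i : ℕ) (v : R ⊗[ℂ] L) : (r a ^ i) v = (a ^ i) v := by
    induction i generalizing v with
    | zero => rfl
    | succ i ih => rw [pow_succ, pow_succ, Module.End.mul_apply, Module.End.mul_apply, ih]; rfl
  have hexp (v : R ⊗[ℂ] L) :
      (∑ i ∈ Finset.range (k + 2), (i.factorial : ℂ)⁻¹ • r a ^ i) v =
        (∑ i ∈ Finset.range (k + 2), (i.factorial : ℂ)⁻¹ • a ^ i) v := by
    simp [LinearMap.sum_apply, hpow]
  have key := exp_mul_of_commutators (X := r a) (T := connectionOperator d A)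
    (B := r (LieAlgebra.ad R _ B)) (C := r (LieAlgebra.ad R _ ⁅x, B⁆)) (k := k)
    (by refine LinearMap.ext fun w => ?_; simp [hpow, hk]) (by
      refine LinearMap.ext fun w => ?_
      simp [hr, ha, connectionOperator, hB, rTensor_derivation_lie]
      abel)
    (by
      refine LinearMap.ext fun w => ?_
      simp [hr, ha])
    (by
      refine LinearMap.ext fun w => ?_
      have := leibniz_lie x ⁅x, B⁆ w
      rw [h3, zero_lie, zero_add] at this
      simpa [hr, ha] using this)
  have := LinearMap.congr_fun key v
  rw [Module.End.mul_apply, Module.End.mul_apply, hexp, hexp] at this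
  refine this.trans ?_
  simp [connectionOperator, hr, add_assoc]

lemma isNilpotent_ad_tmul {e : L} (he : IsNilpotent (LieAlgebra.ad ℂ L e)) (c : R) :
    IsNilpotent (LieAlgebra.ad R (R ⊗[ℂ] L) (c ⊗ₜ e)) := by
  obtain ⟨k, hk⟩ := he
  have hpow (i : ℕ) (r : R) (l : L) : (LieAlgebra.ad R (R ⊗[ℂ] L) (c ⊗ₜ e) ^ i) (r ⊗ₜ l) =
      (c ^ i * r) ⊗ₜ (LieAlgebra.ad ℂ L e ^ i) l := by
    induction i generalizing r l with
    | zero => simp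
    | succ i ih =>
      simp only [pow_succ, Module.End.mul_apply, LieAlgebra.ad_apply,
        LieAlgebra.ExtendScalars.bracket_tmul, ih, mul_assoc]
  refine ⟨k, LinearMap.ext fun v => ?_⟩
  induction v with
  | zero => simp
  | tmul r l => rw [hpow, hk]; simp
  | add x y hx hy => rw [map_add, map_add, hx, hy]

/-- The gauge transformation by `exp (-s e)`, with `s = t⁻¹`, replaces the polar part `s h` of the
connection by `s a e`, where `a` is the pairing of `U` with the root of `e`. The terms in `s ^ 2`
cancel because the coefficient of `h` is exactly `s`. -/
lemma gaugeEquiv_of_sl2 (d : Derivation ℂ R R) (n : Submodule ℂ L) {p h e : L} {s a : R}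
    {U : R ⊗[ℂ] L} (hs : d s = -s ^ 2) (hep : ⁅e, p⁆ = h) (hhe : ⁅h, e⁆ = 2 • e)
    (hU : ⁅U, (1 : R) ⊗ₜ[ℂ] e⁆ = a ⊗ₜ e) (he : e ∈ n) (hnil : IsNilpotent (LieAlgebra.ad ℂ L e)) :
    GaugeEquiv d n (1 ⊗ₜ p + s ⊗ₜ h - U) (1 ⊗ₜ p - U - (s * a) ⊗ₜ e) := by
  have hxU (c : R) : ⁅c ⊗ₜ[ℂ] e, U⁆ = -((c * a) ⊗ₜ e) := by
    rw [← lie_skew, show c ⊗ₜ[ℂ] e = c • ((1 : R) ⊗ₜ[ℂ] e) by simp [TensorProduct.smul_tmul'],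
      lie_smul, hU, TensorProduct.smul_tmul', smul_eq_mul]
  have heh : ⁅e, h⁆ = -(2 • e) := by rw [← lie_skew, hhe]
  have hB : (-s) ⊗ₜ[ℂ] h + (s ^ 2) ⊗ₜ[ℂ] e - (s * a) ⊗ₜ e =
      ⁅(-s) ⊗ₜ[ℂ] e, 1 ⊗ₜ p + s ⊗ₜ h - U⁆ -
        LinearMap.rTensor L (d : R →ₗ[ℂ] R) ((-s) ⊗ₜ[ℂ] e) := by
    simp only [lie_sub, lie_add, hxU, LieAlgebra.ExtendScalars.bracket_tmul, hep, heh,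
      LinearMap.rTensor_tmul, Derivation.coeFn_coe, map_neg, hs, mul_one]
    simp only [TensorProduct.tmul_neg, TensorProduct.neg_tmul, neg_mul, TensorProduct.tmul_smul,
      pow_two, neg_neg]
    abel
  have hC : ⁅(-s) ⊗ₜ[ℂ] e, (-s) ⊗ₜ[ℂ] h + (s ^ 2) ⊗ₜ[ℂ] e - (s * a) ⊗ₜ e⁆ =
      -(2 • ((s ^ 2) ⊗ₜ[ℂ] e)) := by
    simp [heh, TensorProduct.tmul_neg, TensorProduct.neg_tmul, TensorProduct.tmul_smul, pow_two]
  have := gaugeEquiv_exp d n (Submodule.tmul_mem_baseChange_of_mem (-s) he)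
    (isNilpotent_ad_tmul hnil (-s)) hB (by rw [hC]; simp)
  rw [hC] at this
  convert this using 1
  rw [smul_neg, ← Nat.cast_smul_eq_nsmul ℂ, smul_smul]
  simp only [TensorProduct.neg_tmul]
  norm_num
  abel

end Gauge

/-! ### Linear forms on the scalars and horizontal sections -/

section Scalars

variable {R : Type*} [CommRing R] [Algebra ℂ R] {S : Type*} [CommRing S] [Algebra ℂ S]
  {L : Type*} [LieRing L] [LieAlgebra ℂ L]

/-- The map `R ⊗ L → L` given by a linear form on `R`. -/
def contractLeft (L : Type*) [LieRing L] [LieAlgebra ℂ L] (c : R →ₗ[ℂ] ℂ) : R ⊗[ℂ] L →ₗ[ℂ] L :=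
  TensorProduct.lid ℂ L ∘ₗ LinearMap.rTensor L c

@[simp] lemma contractLeft_tmul (c : R →ₗ[ℂ] ℂ) (a : R) (l : L) :
    contractLeft L c (a ⊗ₜ l) = c a • l := rfl

lemma contractLeft_lie {κ : Type*} (c : R →ₗ[ℂ] ℂ) (s : Finset κ) (c₁ c₂ : κ → R →ₗ[ℂ] ℂ)
    (hc : ∀ a b, c (a * b) = ∑ p ∈ s, c₁ p a * c₂ p b) (x y : R ⊗[ℂ] L) :
    contractLeft L c ⁅x, y⁆ =
      ∑ p ∈ s, ⁅contractLeft L (c₁ p) x, contractLeft L (c₂ p) y⁆ := by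
  induction x with
  | zero => simp
  | tmul a l =>
    induction y with
    | zero => simp
    | tmul b k => simp [hc, Finset.sum_smul, smul_smul, mul_comm]
    | add x y hx hy => simp only [lie_add, map_add, hx, hy, Finset.sum_add_distrib]
  | add x y hx hy => simp only [add_lie, map_add, hx, hy, Finset.sum_add_distrib]

lemma contractLeft_one_tmul_lie (c : R →ₗ[ℂ] ℂ) (r : L) (u : R ⊗[ℂ] L) :
    contractLeft L c ⁅(1 : R) ⊗ₜ[ℂ] r, u⁆ =
      ⁅r, contractLeft L c u⁆ := by
  induction u with
  | zero => simp
  | tmul a l => simp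
  | add x y hx hy => simp only [lie_add, map_add, hx, hy]

/-- If `v = t ^ (-n) u` is horizontal for a connection with a simple pole at `t = 0` and residue
`r`, then `u` satisfies the differential equation obtained by clearing denominators. -/
lemma smul_connectionOperator_eq_of_horizontal {d : Derivation ℂ R R} {d' : Derivation ℂ S S}
    {φ : R →ₐ[ℂ] S} (hφ : ∀ r, φ (d r) = d' (φ r))
    (hinj : Function.Injective (changeRing L φ)) {t : R} {s : S} (ht : φ t * s = 1) (hdt : d t = 1)
    {r : L} {A u : R ⊗[ℂ] L} {v : S ⊗[ℂ] L} {n : ℕ}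
    (hv : connectionOperator d' (s ⊗ₜ r + changeRing L φ A) v = 0)
    (hu : φ (t ^ n) • v = changeRing L φ u) :
    t • connectionOperator d A u + ⁅(1 : R) ⊗ₜ[ℂ] r, u⁆ = (n : ℂ) • u := by
  apply hinj
  have h1 := connectionOperator_smul d' (s ⊗ₜ r + changeRing L φ A) (φ (t ^ n)) v
  rw [hv, smul_zero, add_zero, ← hφ, Derivation.leibniz_pow, hdt, hu] at h1
  have h2 : φ t • (φ (n • t ^ (n - 1) • (1 : R)) • v) = (n : ℂ) • changeRing L φ u := by
    rw [← hu, smul_smul, ← map_mul, Nat.cast_smul_eq_nsmul ℂ, ← smul_assoc n (φ (t ^ n)) v,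
      ← map_nsmul φ]
    congr 2
    cases n with
    | zero => simp
    | succ n => simp [pow_succ, mul_comm]; ring
  rw [map_add, changeRing_smul, changeRing_connectionOperator φ hφ, changeRing_lie,
    changeRing_tmul, map_smul, ← h2, ← h1]
  simp only [connectionOperator, LinearMap.add_apply, LinearMap.restrictScalars_apply,
    LieAlgebra.ad_apply, add_lie, smul_add]
  rw [← smul_lie (φ t) (s ⊗ₜ[ℂ] r), TensorProduct.smul_tmul', smul_eq_mul, ht, map_one]
  abel

end Scalars

/-! ### Connections on the punctured disc and their monodromy -/

section Disc

lemma exists_X_pow_mul_eq_discToPunctured (x : PuncturedDiscRing) :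
    ∃ (n : ℕ) (y : DiscRing), discToPunctured (PowerSeries.X ^ n) * x = discToPunctured y := by
  obtain ⟨a, b, hb, rfl⟩ := IsFractionRing.div_surjective (A := DiscRing) x
  have hb := nonZeroDivisors.ne_zero hb
  have hu : IsUnit b.divXPowOrder := by
    rw [PowerSeries.isUnit_iff_constantCoeff, isUnit_iff_ne_zero]
    exact fun h => hb (PowerSeries.constantCoeff_divXPowOrder_eq_zero_iff.1 h)
  obtain ⟨u, hu⟩ := hu
  have hι (y : DiscRing) : algebraMap DiscRing PuncturedDiscRing y = discToPunctured y := rfl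
  have h1 : discToPunctured (u : DiscRing) * discToPunctured (↑u⁻¹ : DiscRing) = 1 := by
    rw [← map_mul]; simp
  have h2 := congrArg discToPunctured (PowerSeries.X_pow_order_mul_divXPowOrder (f := b))
  rw [map_mul, ← hu] at h2
  have hb' : discToPunctured b ≠ 0 := (map_ne_zero_iff _
    (IsFractionRing.injective DiscRing PuncturedDiscRing)).2 hb
  refine ⟨b.order.toNat, a * (↑u⁻¹ : DiscRing), ?_⟩
  rw [hι, hι, map_mul, mul_div_assoc', div_eq_iff hb']
  linear_combination discToPunctured a * discToPunctured (↑u⁻¹ : DiscRing) * h2 -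
    discToPunctured a * discToPunctured (PowerSeries.X ^ b.order.toNat) * h1

lemma discToPunctured_X_ne_zero : discToPunctured (PowerSeries.X : DiscRing) ≠ 0 :=
  (map_ne_zero_iff _ (IsFractionRing.injective DiscRing PuncturedDiscRing)).2 PowerSeries.X_ne_zero

lemma puncturedDeriv_X : puncturedDeriv (discToPunctured (PowerSeries.X : DiscRing)) = 1 := by
  rw [← discToPunctured_deriv, discDeriv, PowerSeries.derivative_X, map_one]

lemma puncturedDeriv_X_inv : puncturedDeriv (discToPunctured (PowerSeries.X : DiscRing))⁻¹ =
    -(discToPunctured (PowerSeries.X : DiscRing))⁻¹ ^ 2 := by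
  rw [Derivation.leibniz_inv, puncturedDeriv_X, smul_eq_mul, mul_one]

variable {L : Type*} [LieRing L] [LieAlgebra ℂ L]

/-- The coefficient of `t ^ m` of an element of `L⟦t⟧ = ℂ⟦t⟧ ⊗ L`. -/
def tensorCoeff (m : ℕ) : DiscRing ⊗[ℂ] L →ₗ[ℂ] L :=
  contractLeft (R := DiscRing) L (PowerSeries.coeff (R := ℂ) m)

@[simp] lemma tensorCoeff_tmul (m : ℕ) (a : DiscRing) (l : L) :
    tensorCoeff m (a ⊗ₜ[ℂ] l) = PowerSeries.coeff m a • l := rfl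

lemma tensorCoeff_lie (m : ℕ) (x y : DiscRing ⊗[ℂ] L) :
    tensorCoeff m ⁅x, y⁆ =
      ∑ p ∈ Finset.HasAntidiagonal.antidiagonal m, ⁅tensorCoeff p.1 x, tensorCoeff p.2 y⁆ :=
  contractLeft_lie (R := DiscRing) (PowerSeries.coeff (R := ℂ) m)
    (Finset.HasAntidiagonal.antidiagonal m)
    (fun p => PowerSeries.coeff (R := ℂ) p.1) (fun p => PowerSeries.coeff (R := ℂ) p.2)
    (fun a b => PowerSeries.coeff_mul m a b) x y

lemma tensorCoeff_one_tmul_lie (m : ℕ) (r : L) (u : DiscRing ⊗[ℂ] L) :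
    tensorCoeff m ⁅(1 : DiscRing) ⊗ₜ[ℂ] r, u⁆ = ⁅r, tensorCoeff m u⁆ :=
  contractLeft_one_tmul_lie _ r u

lemma tensorCoeff_deriv (m : ℕ) (x : DiscRing ⊗[ℂ] L) :
    tensorCoeff m (LinearMap.rTensor L (discDeriv : DiscRing →ₗ[ℂ] DiscRing) x) =
      ((m : ℂ) + 1) • tensorCoeff (m + 1) x := by
  induction x with
  | zero => simp
  | tmul a l => simp [discDeriv, PowerSeries.coeff_derivative, smul_smul, mul_comm]
  | add x y hx hy => simp only [map_add, hx, hy, smul_add]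

lemma tensorCoeff_succ_X_smul (m : ℕ) (x : DiscRing ⊗[ℂ] L) :
    tensorCoeff (m + 1) ((PowerSeries.X : DiscRing) • x) = tensorCoeff m x := by
  induction x with
  | zero => simp
  | tmul a l => rw [TensorProduct.smul_tmul', smul_eq_mul, tensorCoeff_tmul, tensorCoeff_tmul,
      PowerSeries.coeff_succ_X_mul]
  | add x y hx hy => simp only [map_add, hx, hy, smul_add]

lemma tensorCoeff_zero_X_smul (x : DiscRing ⊗[ℂ] L) :
    tensorCoeff 0 ((PowerSeries.X : DiscRing) • x) = 0 := by
  induction x with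
  | zero => simp
  | tmul a l => rw [TensorProduct.smul_tmul', smul_eq_mul, tensorCoeff_tmul,
      PowerSeries.coeff_zero_X_mul, zero_smul]
  | add x y hx hy => simp only [map_add, hx, hy, smul_add, add_zero]

lemma eq_zero_of_tensorCoeff {x : DiscRing ⊗[ℂ] L} (h : ∀ m, tensorCoeff m x = 0) : x = 0 := by
  let B := Module.Basis.ofVectorSpace ℂ L
  have key (i) (m : ℕ) (x : DiscRing ⊗[ℂ] L) :
      PowerSeries.coeff m ((Algebra.TensorProduct.basis DiscRing B).repr x i) =
        B.repr (tensorCoeff m x) i := by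
    induction x with
    | zero => simp
    | tmul a l => simp [Algebra.TensorProduct.basis_repr_tmul]
    | add x y hx hy => simp only [map_add, hx, hy, Finsupp.add_apply]
  apply (Algebra.TensorProduct.basis DiscRing B).repr.injective
  ext i m
  rw [key, h]
  simp

lemma exists_tensorCoeff_eq [FiniteDimensional ℂ L] (f : ℕ → L) :
    ∃ x : DiscRing ⊗[ℂ] L, ∀ m, tensorCoeff m x = f m := by
  let B := Module.finBasis ℂ L
  refine ⟨∑ i, PowerSeries.mk (fun m => B.repr (f m) i) ⊗ₜ B i, fun m => ?_⟩
  simp [B.sum_repr]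

variable (L) in
lemma changeRing_discToPunctured_injective :
    Function.Injective (changeRing L discToPunctured) :=
  Module.Flat.rTensor_preserves_injective_linearMap _
    (IsFractionRing.injective DiscRing PuncturedDiscRing)

lemma exists_X_pow_smul_eq_changeRing (v : PuncturedDiscRing ⊗[ℂ] L) :
    ∃ (n : ℕ) (u : DiscRing ⊗[ℂ] L),
      discToPunctured (PowerSeries.X ^ n) • v = changeRing L discToPunctured u := by
  induction v with
  | zero => exact ⟨0, 0, by simp⟩
  | tmul a l =>
    obtain ⟨n, y, h⟩ := exists_X_pow_mul_eq_discToPunctured a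
    exact ⟨n, y ⊗ₜ l, by rw [TensorProduct.smul_tmul', smul_eq_mul, h, changeRing_tmul]⟩
  | add x y hx hy =>
    obtain ⟨n, u, hu⟩ := hx
    obtain ⟨n', u', hu'⟩ := hy
    refine ⟨n + n', (PowerSeries.X ^ n' : DiscRing) • u + (PowerSeries.X ^ n : DiscRing) • u', ?_⟩
    rw [map_add, changeRing_smul, changeRing_smul, ← hu, ← hu', smul_smul, smul_smul, ← map_mul,
      ← map_mul, smul_add, pow_add, mul_comm]

/-- The elements of a finite-dimensional space of sections over the punctured disc have poles of
bounded order. -/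
lemma exists_uniform_X_pow_smul_mem_range {V : Type*} [AddCommGroup V] [Module ℂ V]
    [FiniteDimensional ℂ V] (ψ : V →ₗ[ℂ] PuncturedDiscRing ⊗[ℂ] L) :
    ∃ n : ℕ, ∀ l, discToPunctured (PowerSeries.X ^ n) • ψ l ∈
      LinearMap.range (changeRing L discToPunctured) := by
  let B := Module.finBasis ℂ V
  choose k hk using fun i => exists_X_pow_smul_eq_changeRing (ψ (B i))
  refine ⟨∑ i, k i, fun l => ?_⟩
  rw [← B.sum_repr l, map_sum, Finset.smul_sum]
  refine Submodule.sum_mem _ fun i _ => ?_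
  obtain ⟨u, hu⟩ := hk i
  rw [map_smul, smul_comm, ← Finset.add_sum_erase _ _ (Finset.mem_univ i), add_comm, pow_add,
    map_mul, mul_smul, hu, ← changeRing_smul]
  exact Submodule.smul_mem _ _ (LinearMap.mem_range_self _ _)

/-- The Taylor coefficients of the horizontal section of `∂ + ∑ A i * t ^ i` with initial value
`l`. -/
def horizontalCoeff (A : ℕ → L) (l : L) : ℕ → L
  | 0 => l
  | m + 1 => -(((m : ℂ) + 1)⁻¹ • ∑ j : Fin (m + 1), ⁅A (m - j), horizontalCoeff A l j⁆)

lemma exists_horizontal [FiniteDimensional ℂ L] (A : DiscRing ⊗[ℂ] L) (l : L) :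
    ∃ u : DiscRing ⊗[ℂ] L, connectionOperator discDeriv A u = 0 ∧ tensorCoeff 0 u = l := by
  obtain ⟨u, hu⟩ := exists_tensorCoeff_eq (horizontalCoeff (fun m => tensorCoeff m A) l)
  refine ⟨u, eq_zero_of_tensorCoeff fun m => ?_, by rw [hu, horizontalCoeff]⟩
  have hm : (m : ℂ) + 1 ≠ 0 := by exact_mod_cast m.succ_ne_zero
  simp only [connectionOperator, LinearMap.add_apply, LinearMap.restrictScalars_apply,
    LieAlgebra.ad_apply, map_add, tensorCoeff_deriv, tensorCoeff_lie, hu]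
  rw [← Finset.Nat.sum_antidiagonal_swap, Finset.Nat.sum_antidiagonal_eq_sum_range_succ_mk,
    horizontalCoeff, smul_neg, smul_smul, mul_inv_cancel₀ hm, one_smul, Finset.sum_range]
  simp

lemma eq_zero_of_smul_add_lie_eq_zero {r x : L} {c : ℂ} (hc : c ≠ 0)
    (hr : IsNilpotent (LieAlgebra.ad ℂ L r)) (h : c • x + ⁅r, x⁆ = 0) : x = 0 := by
  obtain ⟨k, hk⟩ := hr
  have hpow (i : ℕ) : (LieAlgebra.ad ℂ L r ^ i) x = (-c) ^ i • x := by
    induction i with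
    | zero => simp
    | succ i ih =>
      rw [pow_succ', Module.End.mul_apply, ih, map_smul, LieAlgebra.ad_apply,
        (neg_eq_of_add_eq_zero_right h).symm, pow_succ, ← neg_smul, smul_smul]
  have := hpow k
  rw [hk, LinearMap.zero_apply, eq_comm, smul_eq_zero] at this
  exact this.resolve_left (pow_ne_zero _ (neg_ne_zero.2 hc))

/-- The recursion of Frobenius for the horizontal sections `t ^ (-n) u` of a connection with a
simple pole and residue `r`. -/
lemma tensorCoeff_recursion {r : L} {A u : DiscRing ⊗[ℂ] L} {n : ℕ}
    (h : (PowerSeries.X : DiscRing) • connectionOperator discDeriv A u +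
      ⁅(1 : DiscRing) ⊗ₜ[ℂ] r, u⁆ = (n : ℂ) • u) {m : ℕ} (hm : ∀ j < m, tensorCoeff j u = 0) :
    ((m : ℂ) - n) • tensorCoeff m u + ⁅r, tensorCoeff m u⁆ = 0 := by
  have h2 := congrArg (tensorCoeff m) h
  rw [map_add, tensorCoeff_one_tmul_lie, LinearMap.map_smul] at h2
  rw [sub_smul, ← h2]
  cases m with
  | zero =>
    rw [tensorCoeff_zero_X_smul, Nat.cast_zero, zero_smul]
    abel
  | succ m =>
    have h3 : tensorCoeff m ⁅A, u⁆ = 0 := by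
      rw [tensorCoeff_lie]
      refine Finset.sum_eq_zero fun p hp => ?_
      rw [hm p.2 (by have := Finset.HasAntidiagonal.mem_antidiagonal.1 hp; omega), lie_zero]
    rw [tensorCoeff_succ_X_smul, connectionOperator, LinearMap.add_apply, map_add,
      tensorCoeff_deriv, LinearMap.restrictScalars_apply, LieAlgebra.ad_apply, h3]
    push_cast
    abel

/-- A connection on the punctured disc with a simple pole and a nilpotent residue `r` has trivial
monodromy in the adjoint representation only if `ad r = 0`; in particular `ad r = 0` if it is gauge
equivalent to a regular connection.
The regular connection has a horizontal section with each initial value in `L`. These are carried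
to horizontal sections `t ^ (-n) u` of the singular connection, and the recursion for the
coefficients of `u`, together with the nilpotency of `ad r`, shows that the coefficients below
degree `n` vanish, that the one in degree `n` commutes with `r` and that it determines `u`.
By equality of dimensions every element of `L` arises as such a coefficient. -/
lemma ad_eq_zero_of_gaugeEquiv_regular [FiniteDimensional ℂ L] {n : Submodule ℂ L} {r : L}
    {A A' : DiscRing ⊗[ℂ] L} (hr : IsNilpotent (LieAlgebra.ad ℂ L r))
    (h : GaugeEquiv puncturedDeriv n
      ((discToPunctured (PowerSeries.X : DiscRing))⁻¹ ⊗ₜ r + changeRing L discToPunctured A)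
      (changeRing L discToPunctured A')) : LieAlgebra.ad ℂ L r = 0 := by
  obtain ⟨g, -, hg⟩ := h
  let S := LinearMap.ker (connectionOperator discDeriv A')
  obtain ⟨σ, hσ⟩ := ((tensorCoeff 0).domRestrict S).exists_rightInverse_of_surjective (by
    rw [LinearMap.range_eq_top]
    intro l
    obtain ⟨u, hu, hl⟩ := exists_horizontal A' l
    exact ⟨⟨u, hu⟩, hl⟩)
  let ψ : L →ₗ[ℂ] PuncturedDiscRing ⊗[ℂ] L := (g.symm.toLinearMap.restrictScalars ℂ) ∘ₗ
    changeRing L discToPunctured ∘ₗ S.subtype ∘ₗ σ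
  have hψ (l : L) : connectionOperator puncturedDeriv
      ((discToPunctured (PowerSeries.X : DiscRing))⁻¹ ⊗ₜ r + changeRing L discToPunctured A)
      (ψ l) = 0 := by
    apply g.injective
    rw [hg, map_zero]
    have : g (ψ l) = changeRing L discToPunctured (σ l).1 := g.apply_symm_apply _
    rw [this, ← changeRing_connectionOperator discToPunctured discToPunctured_deriv,
      LinearMap.mem_ker.1 (σ l).2, map_zero]
  -- `ψ l` is the horizontal section of the singular connection obtained from the one with initial
  -- value `l`. A common bound `k` for the pole orders makes `u` linear and `l ↦ u_k` an
  -- endomorphism of `L`.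
  obtain ⟨k, hk⟩ := exists_uniform_X_pow_smul_mem_range ψ
  obtain ⟨π, hπ⟩ := (changeRing L discToPunctured).exists_leftInverse_of_injective
    (LinearMap.ker_eq_bot.2 (changeRing_discToPunctured_injective L))
  let u : L →ₗ[ℂ] DiscRing ⊗[ℂ] L :=
    π ∘ₗ (LinearMap.lsmul PuncturedDiscRing _ (discToPunctured (PowerSeries.X ^ k))
      |>.restrictScalars ℂ) ∘ₗ ψ
  have hu (l : L) : discToPunctured (PowerSeries.X ^ k) • ψ l =
      changeRing L discToPunctured (u l) := by
    obtain ⟨y, hy⟩ := hk l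
    have h1 : u l = π (changeRing L discToPunctured y) := by rw [hy]; rfl
    rw [h1, ← LinearMap.comp_apply π, hπ, LinearMap.id_apply, hy]
  have hrec (l : L) := smul_connectionOperator_eq_of_horizontal discToPunctured_deriv
    (changeRing_discToPunctured_injective L) (mul_inv_cancel₀ discToPunctured_X_ne_zero)
    PowerSeries.derivative_X (hψ l) (hu l)
  have hlow (l : L) (m : ℕ) (hm : m < k) : tensorCoeff m (u l) = 0 := by
    induction m using Nat.strong_induction_on with
    | _ m ih =>
      refine eq_zero_of_smul_add_lie_eq_zero ?_ hr
        (tensorCoeff_recursion (hrec l) fun j hj => ih j hj (hj.trans hm))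
      rw [sub_ne_zero]
      exact_mod_cast hm.ne
  -- In degree `k` the scalar `m - k` of the recursion vanishes.
  have hcomm (l : L) : ⁅r, tensorCoeff k (u l)⁆ = 0 := by
    simpa using tensorCoeff_recursion (hrec l) (hlow l)
  have hinj : Function.Injective (tensorCoeff k ∘ₗ u) := by
    rw [← LinearMap.ker_eq_bot, LinearMap.ker_eq_bot']
    intro l hl
    have hul : u l = 0 := by
      refine eq_zero_of_tensorCoeff fun m => ?_
      induction m using Nat.strong_induction_on with
      | _ m ih =>
        rcases eq_or_ne m k with rfl | hmk
        · exact hl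
        · refine eq_zero_of_smul_add_lie_eq_zero ?_ hr (tensorCoeff_recursion (hrec l) ih)
          rw [sub_ne_zero]
          exact_mod_cast hmk
    have h1 := hu l
    rw [hul, map_zero, map_pow, smul_eq_zero_iff_right (pow_ne_zero _ discToPunctured_X_ne_zero)]
      at h1
    have h2 : changeRing L discToPunctured (σ l).1 = 0 :=
      (LinearEquiv.map_eq_zero_iff g.symm).1 h1
    have h3 : (σ l).1 = 0 := changeRing_discToPunctured_injective L (by rw [h2, map_zero])
    have h4 : tensorCoeff 0 (σ l).1 = l := LinearMap.congr_fun hσ l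
    rw [← h4, h3, map_zero]
  ext l
  obtain ⟨l', rfl⟩ := (LinearMap.injective_iff_surjective.1 hinj) l
  exact hcomm l'

end Disc

/-! ### Root spaces of the Langlands dual Lie algebra -/

section LanglandsDual

open LieAlgebra LieAlgebra.IsKilling Module

variable {𝔤 : Type*} [LieRing 𝔤] [LieAlgebra ℂ 𝔤] [FiniteDimensional ℂ 𝔤]
  [LieAlgebra.IsSimple ℂ 𝔤] {𝔥 : LieSubalgebra ℂ 𝔤} [𝔥.IsCartanSubalgebra]
  {𝔤L : Type*} [LieRing 𝔤L] [LieAlgebra ℂ 𝔤L] [FiniteDimensional ℂ 𝔤L]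
  [LieAlgebra.IsSimple ℂ 𝔤L] {𝔥L : LieSubalgebra ℂ 𝔤L} [𝔥L.IsCartanSubalgebra]

lemma dualRoot_isNonZero (D : LanglandsDuality 𝔥 𝔥L) (i : 𝔥.root) : (D.dualRoot i).IsNonZero := by
  exact LieSubalgebra.isNonZero_coe_root (D.indexEquiv i)

lemma coweightMap_dualRoot (D : LanglandsDuality 𝔥 𝔥L) (i : 𝔥.root) :
    D.coweightMap (D.dualRoot i).toLinear = coroot i.1 := by
  have := congrFun D.coroot_coweightMap (D.indexEquiv i)
  simpa [LanglandsDuality.dualRoot] using this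

/-- The identification `𝔥* ≃ 𝔥L` carries the pairing with a coroot of `𝔤` to the pairing with the
corresponding root of the dual Lie algebra. -/
lemma dualRoot_weightMap (D : LanglandsDuality 𝔥 𝔥L) (i : 𝔥.root) (u : Dual ℂ 𝔥) :
    D.dualRoot i (D.weightMap u) = u (coroot i.1) := by
  have := LinearMap.congr_fun (RootPairing.Hom.weight_coweight_transpose_apply _ _
    (D.dualRoot i).toLinear D.toHom) u
  rw [coweightMap_dualRoot] at this
  simpa using this

lemma weightMap_root (D : LanglandsDuality 𝔥 𝔥L) (i : 𝔥.root) :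
    D.weightMap ((rootSystem 𝔥).root i) = coroot (D.dualRoot i) :=
  RootPairing.Hom.root_weightMap_apply _ _ i D.toHom

lemma toCartan_lie_of_mem_rootSpace (D : LanglandsDuality 𝔥 𝔥L) (i : 𝔥.root) {e : 𝔤L}
    (he : e ∈ rootSpace 𝔥L (D.dualRoot i)) (u : Dual ℂ 𝔥) :
    ⁅D.toCartan u, e⁆ = u (coroot i.1) • e := by
  have := lie_eq_smul_of_mem_rootSpace he (D.weightMap u)
  rwa [dualRoot_weightMap] at this

variable {b : (rootSystem 𝔥).Base}

/-- The difference of two distinct simple roots of the dual Lie algebra is not a root. -/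
lemma rootSpace_dualRoot_sub_eq_bot (D : LanglandsDuality 𝔥 𝔥L) {i j : b.support} (hij : i ≠ j) :
    rootSpace 𝔥L ((D.dualRoot i : 𝔥L → ℂ) + -(D.dualRoot j : 𝔥L → ℂ)) = ⊥ := by
  by_contra h
  let χ : LieModule.Weight ℂ 𝔥L 𝔤L := ⟨_, h⟩
  have hχ : χ.toLinear = (D.dualRoot i).toLinear - (D.dualRoot j).toLinear := by
    ext x
    simp [χ, sub_eq_add_neg]
  by_cases h0 : χ.IsZero
  · have : χ.toLinear = 0 := by simpa using h0
    rw [this, eq_comm, sub_eq_zero] at hχ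
    have h1 : D.dualRoot i = D.dualRoot j := by
      ext x
      exact LinearMap.congr_fun hχ x
    exact hij (Subtype.ext (D.indexEquiv.injective (Subtype.ext h1)))
  · let k : 𝔥L.root := ⟨χ, by simpa using h0⟩
    have h1 : D.dualRoot (D.indexEquiv.symm k) = χ := by
      simp [LanglandsDuality.dualRoot, k]
    have h2 := congrArg D.coweightMap hχ
    rw [← h1, map_sub, coweightMap_dualRoot, coweightMap_dualRoot, coweightMap_dualRoot] at h2
    exact b.sub_notMem_range_coroot i.2 j.2 ⟨_, h2⟩

/-- The generator `e` for which `e`, `h`, `f i` is an `sl₂`-triple, where `h` is the coroot which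
corresponds to the root `i` of `𝔤`. The bracket `[e, p₋₁]` is `[e, f i] = h`, because `[e, f j]`
lies in the zero space of `αᵢ - αⱼ` for `j ≠ i`. -/
lemma exists_posGenerator (D : LanglandsDuality 𝔥 𝔥L) {f : b.support → 𝔤L}
    (hf : D.IsNegGenerators b f) (i : b.support) :
    ∃ e ∈ rootSpace 𝔥L (D.dualRoot i), e ≠ 0 ∧
      ⁅e, ∑ j, f j⁆ = D.toCartan ((rootSystem 𝔥).root i) := by
  have hα := dualRoot_isNonZero D i
  obtain ⟨h, e, f', ht, he, hf'⟩ := exists_isSl2Triple_of_weight_isNonZero hα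
  obtain ⟨hfi0, hfi⟩ := hf i
  have hα' : (-(D.dualRoot i) : LieModule.Weight ℂ 𝔥L 𝔤L).IsNonZero := by simpa using hα
  have h1 := finrank_rootSpace_eq_one _ hα'
  rw [LieModule.Weight.coe_neg] at h1
  obtain ⟨c, hc⟩ := (finrank_eq_one_iff_of_nonzero' (⟨f i, hfi⟩ : rootSpace 𝔥L _)
    (by simpa using hfi0)).1 h1 ⟨f', hf'⟩
  have hc : c • f i = f' := congrArg Subtype.val hc
  have hc0 : c ≠ 0 := by
    rintro rfl
    exact ht.f_ne_zero (by rw [← hc, zero_smul])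
  refine ⟨c • e, Submodule.smul_mem _ c he, smul_ne_zero hc0 ht.e_ne_zero, ?_⟩
  rw [lie_sum, Finset.sum_eq_single i]
  · rw [smul_lie, ← lie_smul, hc, ht.lie_e_f, ht.h_eq_coroot hα he hf']
    exact congrArg Subtype.val (weightMap_root D i).symm
  · intro j _ hji
    have : ⁅e, f j⁆ ∈
        rootSpace 𝔥L ((D.dualRoot i : 𝔥L → ℂ) + -(D.dualRoot j : 𝔥L → ℂ)) :=
      lie_mem_genWeightSpace_of_mem_genWeightSpace he (hf j).2
    rw [rootSpace_dualRoot_sub_eq_bot D hji.symm, LieSubmodule.mem_bot] at this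
    rw [smul_lie, this, smul_zero]
  · simp

lemma mem_dualNilradical (D : LanglandsDuality 𝔥 𝔥L) (i : b.support) {e : 𝔤L}
    (he : e ∈ rootSpace 𝔥L (D.dualRoot i)) : e ∈ D.dualNilradical b :=
  Submodule.mem_iSup_of_mem i.1
    (Submodule.mem_iSup_of_mem (b.isPos_of_mem_support i.2) he)

lemma isNilpotent_ad_of_mem_dualRoot (D : LanglandsDuality 𝔥 𝔥L) (i : 𝔥.root) {e : 𝔤L}
    (he : e ∈ rootSpace 𝔥L (D.dualRoot i)) : IsNilpotent (LieAlgebra.ad ℂ 𝔤L e) :=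
  LieAlgebra.isNilpotent_ad_of_mem_rootSpace 𝔥L (fun h => dualRoot_isNonZero D i h) he

end LanglandsDual

/-! ### The local regularity criterion -/

section Regularity

variable {L : Type*} [LieRing L] [LieAlgebra ℂ L]

lemma sum_tmul_sub_sum_tmul_lie {R ι κ : Type*} [CommRing R] [Algebra ℂ R] (s : Finset ι)
    (s' : Finset κ) {x : ι → R} {y : κ → R} {l : ι → L} {l' : κ → L} {p : ι → ℂ} {q : κ → ℂ} {e : L}
    (hl : ∀ i, ⁅l i, e⁆ = p i • e) (hl' : ∀ k, ⁅l' k, e⁆ = q k • e) :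
    ⁅∑ i ∈ s, x i ⊗ₜ[ℂ] l i - ∑ k ∈ s', y k ⊗ₜ[ℂ] l' k, (1 : R) ⊗ₜ[ℂ] e⁆ =
      (∑ i ∈ s, p i • x i - ∑ k ∈ s', q k • y k) ⊗ₜ[ℂ] e := by
  simp [sub_lie, sum_lie, hl, hl', TensorProduct.sub_tmul, TensorProduct.sum_tmul,
    TensorProduct.smul_tmul]

lemma pMinusOne_sub_mem {R : Type*} [CommRing R] [Algebra ℂ R] {F : OperFrame L}
    {x : R ⊗[ℂ] L} (hx : x ∈ F.borel.baseChange R) :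
    1 ⊗ₜ[ℂ] F.pMinusOne - x - 1 ⊗ₜ[ℂ] F.pMinusOne ∈ F.borel.baseChange R := by
  rw [sub_sub_cancel_left]
  exact Submodule.neg_mem _ hx

/-- An oper whose polar part at `t = 0` is `t⁻¹ h`, with `h` a simple coroot, is regular if and
only if the root `α` of `e` pairs to zero with the value at `t = 0` of the regular part. -/
lemma isRegular_mk_iff [FiniteDimensional ℂ L] {F : OperFrame L} {h e : L}
    {u : DiscRing ⊗[ℂ] L} {a : DiscRing} (hep : ⁅e, F.pMinusOne⁆ = h) (hhe : ⁅h, e⁆ = 2 • e)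
    (hu : ⁅u, (1 : DiscRing) ⊗ₜ[ℂ] e⁆ = a ⊗ₜ e) (he : e ∈ F.nilradical)
    (hle : F.nilradical ≤ F.borel) (hub : u ∈ F.borel.baseChange DiscRing)
    (hnil : IsNilpotent (LieAlgebra.ad ℂ L e)) (he0 : e ≠ 0) {A : OperForm PuncturedDiscRing F}
    (hA : A.1 = 1 ⊗ₜ F.pMinusOne + (discToPunctured (PowerSeries.X : DiscRing))⁻¹ ⊗ₜ h -
      changeRing L discToPunctured u) :
    Oper.IsRegular (Quotient.mk (operSetoid puncturedDeriv F) A) ↔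
      PowerSeries.constantCoeff a = 0 := by
  set t : PuncturedDiscRing := discToPunctured (PowerSeries.X : DiscRing) with ht
  have ht0 : t ≠ 0 := discToPunctured_X_ne_zero
  have hU : ⁅changeRing L discToPunctured u, (1 : PuncturedDiscRing) ⊗ₜ[ℂ] e⁆ =
      discToPunctured a ⊗ₜ e := by
    have := congrArg (changeRing L discToPunctured) hu
    rwa [changeRing_lie, changeRing_tmul, changeRing_tmul, map_one] at this
  have hg := gaugeEquiv_of_sl2 puncturedDeriv F.nilradical puncturedDeriv_X_inv hep hhe hU he hnil
  rw [← ht, ← hA] at hg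
  obtain ⟨a₁, ha₁⟩ : ∃ a₁ : DiscRing,
      a = PowerSeries.X * a₁ + PowerSeries.C (PowerSeries.constantCoeff a) :=
    ⟨_, PowerSeries.eq_X_mul_shift_add_const a⟩
  set c := PowerSeries.constantCoeff a
  have hta : t⁻¹ * discToPunctured a = discToPunctured a₁ + c • t⁻¹ := by
    have hC : discToPunctured (PowerSeries.C c) = algebraMap ℂ PuncturedDiscRing c :=
      discToPunctured.commutes c
    rw [ha₁, map_add, map_mul, hC, ← ht, Algebra.smul_def]
    field_simp
  set u₁ : DiscRing ⊗[ℂ] L := u + a₁ ⊗ₜ e with hu₁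
  have hub₁ : u₁ ∈ F.borel.baseChange DiscRing :=
    add_mem hub (Submodule.tmul_mem_baseChange_of_mem _ (hle he))
  have heq : 1 ⊗ₜ F.pMinusOne - changeRing L discToPunctured u - (t⁻¹ * discToPunctured a) ⊗ₜ e =
      t⁻¹ ⊗ₜ (-(c • e)) +
        changeRing L discToPunctured ((1 : DiscRing) ⊗ₜ F.pMinusOne - u₁) := by
    rw [hta, hu₁, map_sub, map_add, changeRing_tmul, changeRing_tmul, map_one,
      TensorProduct.add_tmul, TensorProduct.tmul_neg, TensorProduct.smul_tmul]
    abel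
  -- `A` is gauge equivalent to an operator with a simple pole and residue `-c e`.
  rw [heq] at hg
  constructor
  · rintro ⟨τ, hτ⟩
    induction τ using Quotient.inductionOn with
    | _ A' =>
      let A₂ : OperForm PuncturedDiscRing F :=
        ⟨t⁻¹ ⊗ₜ (-(c • e)) + changeRing L discToPunctured ((1 : DiscRing) ⊗ₜ F.pMinusOne - u₁), by
          have h1 := (OperForm.map discToPunctured
            ⟨_, pMinusOne_sub_mem hub₁⟩ : OperForm PuncturedDiscRing F).2
          rw [add_sub_assoc]
          exact add_mem (Submodule.tmul_mem_baseChange_of_mem _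
            (neg_mem (Submodule.smul_mem _ c (hle he)))) h1⟩
      have h1 : (operSetoid puncturedDeriv F).r (OperForm.map discToPunctured A') A :=
        Quotient.exact hτ
      have h2 : (operSetoid puncturedDeriv F).r A A₂ := hg
      have h3 : (operSetoid puncturedDeriv F).r A₂ (OperForm.map discToPunctured A') :=
        Setoid.symm' _ (Setoid.trans' _ h1 h2)
      have h4 := ad_eq_zero_of_gaugeEquiv_regular (r := -(c • e)) (by
        rw [map_neg, map_smul]
        exact (hnil.smul c).neg) h3
      have h5 := LinearMap.congr_fun h4 h
      rw [LieAlgebra.ad_apply, neg_lie, smul_lie, ← lie_skew, hhe, smul_neg, neg_neg,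
        LinearMap.zero_apply, smul_eq_zero] at h5
      refine h5.resolve_right ?_
      rw [← Nat.cast_smul_eq_nsmul ℂ]
      exact smul_ne_zero (by norm_num) he0
  · intro hc
    refine ⟨Quotient.mk _ ⟨_, pMinusOne_sub_mem hub₁⟩, Quotient.sound ?_⟩
    refine Setoid.symm' (operSetoid puncturedDeriv F) ?_
    rw [hc, zero_smul, neg_zero, TensorProduct.tmul_zero, zero_add] at hg
    exact hg

end Regularity

/-! ### Laurent expansions of partial fractions -/

section Expansion

/-- The expansion `1 / (t + c)` in powers of `t`, for `c ≠ 0`. -/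
def invSeries (c : ℂ) : DiscRing := (PowerSeries.X + PowerSeries.C c)⁻¹

lemma constantCoeff_invSeries (c : ℂ) : PowerSeries.constantCoeff (invSeries c) = c⁻¹ := by
  simp [invSeries, PowerSeries.constantCoeff_inv]

lemma expandAt_X_sub_C (w a : ℂ) :
    expandAt w (RatFunc.X - RatFunc.C a) =
      discToPunctured (PowerSeries.X + PowerSeries.C (w - a)) := by
  have h1 : (RatFunc.X - RatFunc.C a : RatFunc ℂ) =
      algebraMap (Polynomial ℂ) (RatFunc ℂ) (Polynomial.X - Polynomial.C a) := by
    simp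
  have h2 (p : Polynomial ℂ) :
      expandAt w (algebraMap (Polynomial ℂ) (RatFunc ℂ) p) = taylorAt w p := by
    simp [expandAt]
  rw [h1, h2, taylorAt_apply]
  have h3 : ((Polynomial.taylor w (Polynomial.X - Polynomial.C a) : Polynomial ℂ) : DiscRing) =
      PowerSeries.X + PowerSeries.C (w - a) := by
    simp [add_sub_assoc]
  rw [h3]
  rfl

lemma expandAt_inv_self (w : ℂ) :
    expandAt w (RatFunc.X - RatFunc.C w)⁻¹ = (discToPunctured (PowerSeries.X : DiscRing))⁻¹ := by
  rw [map_inv₀, expandAt_X_sub_C, sub_self, map_zero, add_zero]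

lemma expandAt_inv_of_ne {w a : ℂ} (h : w ≠ a) :
    expandAt w (RatFunc.X - RatFunc.C a)⁻¹ = discToPunctured (invSeries (w - a)) := by
  have h0 : PowerSeries.constantCoeff (PowerSeries.X + PowerSeries.C (w - a)) ≠ 0 := by
    simpa using sub_ne_zero.2 h
  rw [map_inv₀, expandAt_X_sub_C]
  refine inv_eq_of_mul_eq_one_right ?_
  rw [← map_mul, invSeries, PowerSeries.mul_inv_cancel _ h0, map_one]

end Expansion

/-! ### Regularity of the Miura transformation -/

section Miura

open LieAlgebra LieAlgebra.IsKilling Module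

variable {𝔤 : Type*} [LieRing 𝔤] [LieAlgebra ℂ 𝔤] [FiniteDimensional ℂ 𝔤]
  [LieAlgebra.IsSimple ℂ 𝔤] {𝔥 : LieSubalgebra ℂ 𝔤} [𝔥.IsCartanSubalgebra]
  {𝔤L : Type*} [LieRing 𝔤L] [LieAlgebra ℂ 𝔤L] [FiniteDimensional ℂ 𝔤L]
  [LieAlgebra.IsSimple ℂ 𝔤L] {𝔥L : LieSubalgebra ℂ 𝔤L} [𝔥L.IsCartanSubalgebra]
  {b : (rootSystem 𝔥).Base} {N : ℕ} {z : Fin N → ℂ}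

/-- The regular part at `t = w j` of `λ(t)`, in the local coordinate `t - w j`, as an element of
`ᴸ𝔤⟦t⟧`. -/
def regularPart (D : LanglandsDuality 𝔥 𝔥L) (lam : Fin N → Dual ℂ 𝔥) (s : ColouredPoints b z)
    (j : Fin s.m) : DiscRing ⊗[ℂ] 𝔤L :=
  ∑ i, invSeries (s.w j - z i) ⊗ₜ[ℂ] D.toCartan (lam i)
    - ∑ k ∈ Finset.univ.erase j, invSeries (s.w j - s.w k) ⊗ₜ[ℂ] D.toCartan (s.simpleRoot k)

lemma changeRing_expandAt_connection (D : LanglandsDuality 𝔥 𝔥L) (lam : Fin N → Dual ℂ 𝔥)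
    (s : ColouredPoints b z) (j : Fin s.m) (p : 𝔤L) :
    changeRing 𝔤L (expandAt (s.w j)) (1 ⊗ₜ[ℂ] p -
        LinearMap.lTensor (RatFunc ℂ) D.toCartan (s.connection lam).coeff) =
      1 ⊗ₜ p + (discToPunctured (PowerSeries.X : DiscRing))⁻¹ ⊗ₜ D.toCartan (s.simpleRoot j) -
        changeRing 𝔤L discToPunctured (regularPart D lam s j) := by
  simp only [ColouredPoints.connection, regularPart, map_sub, map_sum, LinearMap.lTensor_tmul,
    changeRing_tmul, map_one]
  rw [← Finset.add_sum_erase _ _ (Finset.mem_univ j), expandAt_inv_self,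
    Finset.sum_congr rfl fun i _ => by rw [expandAt_inv_of_ne (s.w_ne j i)],
    Finset.sum_congr (s₁ := Finset.univ.erase j) rfl fun k hk => by
      rw [expandAt_inv_of_ne fun h => (Finset.ne_of_mem_erase hk) (s.w_injective h).symm]]
  abel

lemma regularPart_mem (D : LanglandsDuality 𝔥 𝔥L) (lam : Fin N → Dual ℂ 𝔥)
    (s : ColouredPoints b z) (j : Fin s.m) (f : b.support → 𝔤L) :
    regularPart D lam s j ∈ (D.operFrame b f).borel.baseChange DiscRing := by
  have h (u : Dual ℂ 𝔥) : D.toCartan u ∈ (D.operFrame b f).borel :=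
    Submodule.mem_sup_left (D.weightMap u).2
  exact sub_mem (sum_mem fun _ _ => Submodule.tmul_mem_baseChange_of_mem _ (h _))
    (sum_mem fun _ _ => Submodule.tmul_mem_baseChange_of_mem _ (h _))

/-- The pairing of the regular part of `λ(t)` at `t = w j` with the simple coroot attached to
`w j`. Its constant coefficient is the left-hand side of the Bethe Ansatz equation. -/
def regularPairing (lam : Fin N → Dual ℂ 𝔥) (s : ColouredPoints b z) (j : Fin s.m) : DiscRing :=
  ∑ i, lam i (s.simpleCoroot j) • invSeries (s.w j - z i)
    - ∑ k ∈ Finset.univ.erase j, s.simpleRoot k (s.simpleCoroot j) • invSeries (s.w j - s.w k)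

lemma constantCoeff_regularPairing (lam : Fin N → Dual ℂ 𝔥) (s : ColouredPoints b z)
    (j : Fin s.m) :
    PowerSeries.constantCoeff (regularPairing lam s j) =
      ∑ i, lam i (s.simpleCoroot j) / (s.w j - z i)
        - ∑ k ∈ Finset.univ.erase j, s.simpleRoot k (s.simpleCoroot j) / (s.w j - s.w k) := by
  simp only [regularPairing, map_sub, map_sum, PowerSeries.constantCoeff_smul,
    constantCoeff_invSeries, smul_eq_mul, div_eq_mul_inv]

lemma regularPart_lie (D : LanglandsDuality 𝔥 𝔥L) (lam : Fin N → Dual ℂ 𝔥)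
    (s : ColouredPoints b z) (j : Fin s.m) {e : 𝔤L}
    (he : e ∈ rootSpace 𝔥L (D.dualRoot (s.colour j))) :
    ⁅regularPart D lam s j, (1 : DiscRing) ⊗ₜ[ℂ] e⁆ = regularPairing lam s j ⊗ₜ e := by
  have h (u : Dual ℂ 𝔥) : ⁅D.toCartan u, e⁆ = u (s.simpleCoroot j) • e :=
    toCartan_lie_of_mem_rootSpace D _ he u
  exact sum_tmul_sub_sum_tmul_lie (R := DiscRing) _ _ (fun i => h (lam i))
    (fun k => h (s.simpleRoot k))

/-- The Bethe Ansatz equation at `w j` is the condition that the Miura transformation of the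
connection is regular at `w j`. -/
lemma isRegular_restrictAt_iff (D : LanglandsDuality 𝔥 𝔥L) {f : b.support → 𝔤L}
    (hf : D.IsNegGenerators b f) (lam : Fin N → Dual ℂ 𝔥) (s : ColouredPoints b z)
    (j : Fin s.m) :
    ((miura D b f ratDeriv (s.connection lam)).restrictAt (s.w j)).IsRegular ↔
      ∑ i, lam i (s.simpleCoroot j) / (s.w j - z i)
        - ∑ k ∈ Finset.univ.erase j, s.simpleRoot k (s.simpleCoroot j) / (s.w j - s.w k) = 0 := by
  obtain ⟨e, he, he0, hep⟩ := exists_posGenerator D hf (s.colour j)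
  rw [← constantCoeff_regularPairing]
  refine isRegular_mk_iff (F := D.operFrame b f) hep ?_ (regularPart_lie D lam s j he)
    (mem_dualNilradical D _ he) le_sup_right (regularPart_mem D lam s j f)
    (isNilpotent_ad_of_mem_dualRoot D _ he) he0 (changeRing_expandAt_connection D lam s j _)
  rw [toCartan_lie_of_mem_rootSpace D _ he, rootSystem_root_apply, LieModule.Weight.toLinear_apply,
    root_apply_coroot, ofNat_smul_eq_nsmul]
  exact LieSubalgebra.isNonZero_coe_root _

end Miura

/-! ### Poles and residues of the connection -/

section Residues

open LieAlgebra LieAlgebra.IsKilling Module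

/-- An element of `V((t))` with a pole at `t = 0` is not in `V⟦t⟧`. -/
lemma eq_zero_of_X_inv_tmul_mem_range {V : Type*} [AddCommGroup V] [Module ℂ V] {v : V}
    (h : (discToPunctured (PowerSeries.X : DiscRing))⁻¹ ⊗ₜ[ℂ] v ∈
      LinearMap.range (LinearMap.rTensor V discToPunctured.toLinearMap)) : v = 0 := by
  rw [← Module.forall_dual_apply_eq_zero_iff ℂ]
  intro φ
  obtain ⟨y, hy⟩ := h
  have hcomm : TensorProduct.rid ℂ PuncturedDiscRing ∘ₗ LinearMap.lTensor PuncturedDiscRing φ ∘ₗ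
      LinearMap.rTensor V discToPunctured.toLinearMap =
      discToPunctured.toLinearMap ∘ₗ (TensorProduct.rid ℂ DiscRing).toLinearMap ∘ₗ
        LinearMap.lTensor DiscRing φ := by
    ext r v
    simp
  have h1 := LinearMap.congr_fun hcomm y
  set a : DiscRing := TensorProduct.rid ℂ DiscRing (LinearMap.lTensor DiscRing φ y)
  have h2 : φ v • (discToPunctured (PowerSeries.X : DiscRing))⁻¹ = discToPunctured a := by
    rw [LinearMap.comp_apply, LinearMap.comp_apply, hy] at h1
    exact h1
  have h3 : discToPunctured (PowerSeries.C (φ v)) = discToPunctured (PowerSeries.X * a) := by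
    have hC : discToPunctured (PowerSeries.C (φ v)) = algebraMap ℂ PuncturedDiscRing (φ v) :=
      discToPunctured.commutes (φ v)
    rw [map_mul, ← h2, hC, mul_smul_comm, mul_inv_cancel₀ discToPunctured_X_ne_zero,
      Algebra.algebraMap_eq_smul_one]
  have h4 := congrArg PowerSeries.constantCoeff
    (IsFractionRing.injective DiscRing PuncturedDiscRing h3)
  simpa using h4

variable {𝔤 : Type*} [LieRing 𝔤] [LieAlgebra ℂ 𝔤] [FiniteDimensional ℂ 𝔤]
  [LieAlgebra.IsSimple ℂ 𝔤] {𝔥 : LieSubalgebra ℂ 𝔤} [𝔥.IsCartanSubalgebra]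
  {b : (rootSystem 𝔥).Base} {N : ℕ} {z : Fin N → ℂ}

open scoped Classical in
/-- The simple root attached to the point `w`, and zero if `w` is not one of the points `w j`. -/
def rootAt (s : ColouredPoints b z) (w : ℂ) : Dual ℂ 𝔥 :=
  ∑ k, if s.w k = w then s.simpleRoot k else 0

lemma rootAt_w (s : ColouredPoints b z) (j : Fin s.m) : rootAt s (s.w j) = s.simpleRoot j := by
  rw [rootAt, Finset.sum_eq_single j]
  · rw [if_pos rfl]
  · intro k _ hk
    rw [if_neg fun h => hk (s.w_injective h)]
  · simp

lemma exists_w_eq_of_rootAt_ne_zero {s : ColouredPoints b z} {w : ℂ} (h : rootAt s w ≠ 0) :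
    ∃ j, s.w j = w := by
  contrapose! h
  exact Finset.sum_eq_zero fun k _ => if_neg (h k)

/-- Away from the points `z i`, the polar part of `λ(t)` at `w` is `-t⁻¹ α`, with `α` the simple
root attached to `w`. -/
lemma expandAt_connection_add_mem_range (lam : Fin N → Dual ℂ 𝔥) (s : ColouredPoints b z) {w : ℂ}
    (hw : ∀ i, w ≠ z i) :
    LinearMap.rTensor (Dual ℂ 𝔥) (expandAt w).toLinearMap (s.connection lam).coeff +
        (discToPunctured (PowerSeries.X : DiscRing))⁻¹ ⊗ₜ[ℂ] rootAt s w ∈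
      LinearMap.range (LinearMap.rTensor (Dual ℂ 𝔥) discToPunctured.toLinearMap) := by
  have hmem (x : DiscRing) (v : Dual ℂ 𝔥) : discToPunctured x ⊗ₜ[ℂ] v ∈
      LinearMap.range (LinearMap.rTensor (Dual ℂ 𝔥) discToPunctured.toLinearMap) :=
    ⟨x ⊗ₜ v, rfl⟩
  simp only [ColouredPoints.connection, rootAt, map_sub, map_sum, LinearMap.rTensor_tmul,
    AlgHom.toLinearMap_apply, TensorProduct.tmul_sum]
  rw [sub_add, ← Finset.sum_sub_distrib]
  refine sub_mem (sum_mem fun i _ => ?_) (sum_mem fun k _ => ?_)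
  · rw [expandAt_inv_of_ne (hw i)]
    exact hmem _ _
  · split_ifs with h
    · rw [h, expandAt_inv_self, sub_self]
      exact zero_mem _
    · rw [TensorProduct.tmul_zero, sub_zero, expandAt_inv_of_ne (Ne.symm h)]
      exact hmem _ _

lemma rootAt_eq_of_connection_eq {lam : Fin N → Dual ℂ 𝔥} {s s' : ColouredPoints b z}
    (h : s.connection lam = s'.connection lam) {w : ℂ} (hw : ∀ i, w ≠ z i) :
    rootAt s w = rootAt s' w := by
  have h1 := sub_mem (expandAt_connection_add_mem_range lam s hw)
    (expandAt_connection_add_mem_range lam s' hw)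
  rw [h, add_sub_add_left_eq_sub, ← TensorProduct.tmul_sub] at h1
  exact sub_eq_zero.1 (eq_zero_of_X_inv_tmul_mem_range h1)

lemma exists_eq_of_connection_eq {lam : Fin N → Dual ℂ 𝔥} {s s' : ColouredPoints b z}
    (h : s.connection lam = s'.connection lam) (j : Fin s.m) :
    ∃ j', s'.colour j' = s.colour j ∧ s'.w j' = s.w j := by
  have h1 := rootAt_eq_of_connection_eq h (s.w_ne j)
  rw [rootAt_w] at h1
  obtain ⟨j', hj'⟩ := exists_w_eq_of_rootAt_ne_zero (s := s') (w := s.w j) (by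
    rw [← h1]
    exact (rootSystem 𝔥).ne_zero _)
  rw [← hj', rootAt_w] at h1
  exact ⟨j', Subtype.ext ((rootSystem 𝔥).root.injective h1.symm), hj'⟩

/-- A configuration is determined by its connection: the points are the poles outside the `z i`
and the simple roots are the residues. -/
lemma Configuration.connection_injective (lam : Fin N → Dual ℂ 𝔥) :
    Function.Injective (Configuration.connection (b := b) (z := z) lam) := by
  intro x y hxy
  induction x, y using Quotient.inductionOn₂ with
  | _ s s' =>
    have h : s.connection lam = s'.connection lam := hxy
    choose σ hσ hσ' using exists_eq_of_connection_eq h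
    refine Quotient.sound ⟨Equiv.ofBijective σ ⟨fun j k hjk => ?_, fun j' => ?_⟩, hσ, hσ'⟩
    · exact s.w_injective (by rw [← hσ', ← hσ', hjk])
    · obtain ⟨j, -, hj⟩ := exists_eq_of_connection_eq h.symm j'
      exact ⟨j, s'.w_injective (by rw [hσ', hj])⟩

end Residues

end BetheOper

end

theorem mainTheorem6
    {𝔤 : Type*} [LieRing 𝔤] [LieAlgebra ℂ 𝔤] [FiniteDimensional ℂ 𝔤] [LieAlgebra.IsSimple ℂ 𝔤]
    (𝔥 : LieSubalgebra ℂ 𝔤) [𝔥.IsCartanSubalgebra]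
    (b : (LieAlgebra.IsKilling.rootSystem 𝔥).Base)
    {𝔤L : Type*} [LieRing 𝔤L] [LieAlgebra ℂ 𝔤L] [FiniteDimensional ℂ 𝔤L]
    [LieAlgebra.IsSimple ℂ 𝔤L]
    (𝔥L : LieSubalgebra ℂ 𝔤L) [𝔥L.IsCartanSubalgebra]
    (D : BetheOper.LanglandsDuality 𝔥 𝔥L)
    (f : b.support → 𝔤L) (hf : D.IsNegGenerators b f)
    {N : ℕ} (z : Fin N → ℂ) (hz : Function.Injective z)
    (lam : Fin N → Module.Dual ℂ 𝔥) :
    Set.BijOn (BetheOper.Configuration.connection (b := b) (z := z) lam)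
        (BetheOper.betheSolutions b z lam)
        (BetheOper.genericConnections D b z lam f) ∧
      ∀ lamInf : Module.Dual ℂ 𝔥,
        Set.BijOn (BetheOper.Configuration.connection (b := b) (z := z) lam)
          (BetheOper.betheSolutionsAt b z lam lamInf)
          (BetheOper.genericConnectionsAt D b z lam f lamInf) := by
  have hinj := BetheOper.Configuration.connection_injective (b := b) (z := z) lam
  have hreg (s : BetheOper.ColouredPoints b z) : s.BetheEquations lam ↔
      ∀ j, ((BetheOper.miura D b f BetheOper.ratDeriv (s.connection lam)).restrictAt
        (s.w j)).IsRegular :=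
    forall_congr' fun j => (BetheOper.isRegular_restrictAt_iff D hf lam s j).symm
  refine ⟨⟨?_, hinj.injOn, ?_⟩, fun lamInf => ⟨?_, hinj.injOn, ?_⟩⟩
  · rintro _ ⟨s, rfl, hs⟩
    exact ⟨s, rfl, (hreg s).1 hs⟩
  · rintro _ ⟨s, rfl, hs⟩
    exact ⟨Quotient.mk _ s, ⟨s, rfl, (hreg s).2 hs⟩, rfl⟩
  · rintro _ ⟨s, rfl, hs, hinf⟩
    exact ⟨s, rfl, hinf, (hreg s).1 hs⟩
  · rintro _ ⟨s, rfl, hinf, hs⟩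
    exact ⟨Quotient.mk _ s, ⟨s, rfl, (hreg s).2 hs, hinf⟩, rfl⟩
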